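/- Let $n\ge 1$, let $0\le\alpha_1\le\dots\le\alpha_n<1$ be real numbers and let $\gamma\in\mathbb R$ (for the hypergeometric module, $\gamma=-\sum_i\alpha_i$). Put $\mathcal O=\mathbb C[z,t^{\pm1},\tau]$ and $\mathcal O(*)=\mathbb C[z,t^{\pm1},\tau^{\pm1}]$, and let $$\widehat{\mathcal H}=\mathcal R/\mathcal R(P,H),\qquad \mathcal R=\mathbb C[z,t^{\pm1}]\langle z^2\partial_z,z\partial_t\rangle,\qquad P=z^2\partial_z+nzt\partial_t+\gamma z,\quad H=\prod_{i=1}^n z(t\partial_t-\alpha_i)-t .$$ Let ${}^\tau\widehat{\mathcal H}=\mathcal O(*)\otimes_{\mathbb C[z,t^{\pm1}]}\widehat{\mathcal H}$ be the rescaled module, that is, the pull-back of $\widehat{\mathcal H}$ along $(z,t,\tau)\mapsto(z/\tau,t)$ with the action of $\mathcal R(*)=\mathcal O(*)\langle z^2\partial_z,z\partial_t,z\partial_\tau\rangle$ given by the chain rule: $$z^2\partial_z(f\otimes m)=z^2\tfrac{\partial f}{\partial z}\otimes m+\tau f\otimes z^2\partial_z m,\quad z\partial_t(f\otimes m)=z\tfrac{\partial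 f}{\partial t}\otimes m+\tau f\otimes z\partial_t m,\quad z\partial_\tau(f\otimes m)=z\tfrac{\partial f}{\partial\tau}\otimes m-f\otimes z^2\partial_z m .$$ For $0\le k\le n-1$ let $Q_k\in{}^\tau\widehat{\mathcal H}$ be the class of $(-n)^k\prod_{j=1}^k\frac z\tau(t\partial_t-\alpha_j)$ (applied to $1\otimes[1]$), and for $a\in\mathbb R$ let $${}^\tau U_a=\Bigl\{\sum_{k=0}^{n-1}f_k\tau^{\nu_k}Q_k \;:\; f_k\in\mathcal O,\ \nu_k\in\mathbb Z,\ \max_k\,(k-n\alpha_{k+1}-\gamma-\nu_k)\le a\Bigr\}.$$ A module $M$ over $\mathcal R(*)$ is called strictly $\mathbb R$-specializable along $\tau=0$ if it has a canonical $V$-filtration, i.e. an increasing exhaustive filtration $(V_a)_{a\in\mathbb R}$ by coherent modules over $V_0\mathcal R=\mathcal O\langle z\partial_t,z\tau\partial_\tau\rangle$, with a discrete set of jumps and $V_a=V_{a+\varepsilon}$ for some $\varepsilon>0$ depending on $a$, such that, for all $a$: $\tau V_a=V_{a-1}$; $z\partial_\tau V_a\subseteq V_{a+1}$; $V_a/V_{<a}$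 is strict, i.e. flat over $\mathbb C[z]$; and $z\tau\partial_\tau+az$ is nilpotent on $V_a/V_{<a}$, where $V_{<a}=\bigcup_{b<a}V_b$. Then ${}^\tau\widehat{\mathcal H}$ is strictly $\mathbb R$-specializable along $\tau=0$, and its canonical $V$-filtration is ${}^\tau U_\bullet$: a filtration $(V_a)$ of ${}^\tau\widehat{\mathcal H}$ by $V_0\mathcal R$-submodules is a canonical $V$-filtration if and only if $V_a={}^\tau U_a$ for all $a\in\mathbb R$. Moreover, for every $a\in\mathbb R$, $${}^\tau U_a=\sum_{k=0}^{n-1}\mathcal O\cdot\tau^{\nu_a(k)}Q_k,\qquad \nu_a(k)=\lceil -a+k-\gamma-n\alpha_{k+1}\rceil .$$ -/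

import Mathlib

open scoped TensorProduct

noncomputable section

namespace IrrHodge

/-! ### Algebras of functions and the derivations `x ∂_x` -/

/-- The linear endomorphism `x^g ↦ w(g) x^g` of the monoid algebra `ℂ[G]`. -/
def eulerLin {G : Type} [AddCommMonoid G] (w : G →+ ℂ) :
    AddMonoidAlgebra ℂ G →ₗ[ℂ] AddMonoidAlgebra ℂ G where
  toFun f := f.coeff.sum fun g c => AddMonoidAlgebra.single g (w g * c)
  map_add' f g := by
    rw [AddMonoidAlgebra.coeff_add, Finsupp.sum_add_index'] <;> intros <;> simp [mul_add]
  map_smul' c f := by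
    rw [AddMonoidAlgebra.coeff_smul, Finsupp.sum_smul_index' (by simp), RingHom.id_apply,
      Finsupp.smul_sum]
    refine Finsupp.sum_congr fun x _ => ?_
    simp [mul_left_comm]

theorem eulerLin_single {G : Type} [AddCommMonoid G] (w : G →+ ℂ) (g : G) (c : ℂ) :
    eulerLin w (AddMonoidAlgebra.single g c) = AddMonoidAlgebra.single g (w g * c) := by
  simp [eulerLin]

/-- The derivation of the monoid algebra `ℂ[G]` with `x^g ↦ w(g) x^g`, for an additive weight `w`.
For `w` the exponent of a coordinate `x` this is the Euler derivation `x ∂_x`. -/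
def euler {G : Type} [AddCommMonoid G] (w : G →+ ℂ) :
    Derivation ℂ (AddMonoidAlgebra ℂ G) (AddMonoidAlgebra ℂ G) :=
  Derivation.mk' (eulerLin w) (by
    intro a b
    induction a using AddMonoidAlgebra.induction_linear with
    | zero => simp
    | add x y hx hy => rw [add_mul, map_add, hx, hy, map_add, add_smul, smul_add]; abel
    | single m r =>
      induction b using AddMonoidAlgebra.induction_linear with
      | zero => simp
      | add x y hx hy => rw [mul_add, map_add, hx, hy, map_add, add_smul, smul_add]; abel
      | single m' r' =>
        simp only [AddMonoidAlgebra.single_mul_single, eulerLin_single, smul_eq_mul, map_add,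
          add_comm m' m, ← AddMonoidAlgebra.single_add]
        congr 1
        ring)

theorem euler_single {G : Type} [AddCommMonoid G] (w : G →+ ℂ) (g : G) (c : ℂ) :
    euler w (AddMonoidAlgebra.single g c) = AddMonoidAlgebra.single g (w g * c) :=
  eulerLin_single w g c

/-- `𝒪(𝒳) = ℂ[z, t, t⁻¹]`: the monomial `z^a t^b` is `single (a, b) 1`. -/
abbrev OX : Type := AddMonoidAlgebra ℂ (ℕ × ℤ)

/-- `𝒪(*) = ℂ[z, t, t⁻¹, τ, τ⁻¹]`, the functions on `𝒳 × 𝔸¹_τ` with poles along `τ = 0`: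
the monomial `z^a t^b τ^c` is `single (a, b, c) 1`. -/
abbrev OY : Type := AddMonoidAlgebra ℂ (ℕ × ℤ × ℤ)

namespace OX

def z : OX := AddMonoidAlgebra.single (1, 0) 1
/-- `t ^ b` for an integer `b`. -/
def t (b : ℤ) : OX := AddMonoidAlgebra.single (0, b) 1

/-- `z ∂_z` -/
def zdz : Derivation ℂ OX OX :=
  euler ((Nat.castAddMonoidHom ℂ).comp (AddMonoidHom.fst ℕ ℤ))
/-- `t ∂_t` -/
def tdt : Derivation ℂ OX OX :=
  euler ((Int.castAddHom ℂ).comp (AddMonoidHom.snd ℕ ℤ))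

/-- `z² ∂_z` -/
def Dz : Derivation ℂ OX OX := z • zdz
/-- `z ∂_t` -/
def Dt : Derivation ℂ OX OX := (z * t (-1)) • tdt

end OX

namespace OY

def z : OY := AddMonoidAlgebra.single (1, 0, 0) 1
/-- `t ^ b` for an integer `b`. -/
def t (b : ℤ) : OY := AddMonoidAlgebra.single (0, b, 0) 1
/-- `τ ^ c` for an integer `c`. -/
def tau (c : ℤ) : OY := AddMonoidAlgebra.single (0, 0, c) 1

/-- `z ∂_z` -/
def zdz : Derivation ℂ OY OY :=
  euler ((Nat.castAddMonoidHom ℂ).comp (AddMonoidHom.fst ℕ (ℤ × ℤ)))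
/-- `t ∂_t` -/
def tdt : Derivation ℂ OY OY :=
  euler ((Int.castAddHom ℂ).comp ((AddMonoidHom.fst ℤ ℤ).comp (AddMonoidHom.snd ℕ (ℤ × ℤ))))
/-- `τ ∂_τ` -/
def taudtau : Derivation ℂ OY OY :=
  euler ((Int.castAddHom ℂ).comp ((AddMonoidHom.snd ℤ ℤ).comp (AddMonoidHom.snd ℕ (ℤ × ℤ))))

/-- `z² ∂_z` -/
def Dz : Derivation ℂ OY OY := z • zdz
/-- `z ∂_t` -/
def Dt : Derivation ℂ OY OY := (z * t (-1)) • tdt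
/-- `z ∂_τ` -/
def Dtau : Derivation ℂ OY OY := (z * tau (-1)) • taudtau

end OY

/-- `𝒪(𝒳 × 𝔸¹_τ) = ℂ[z, t, t⁻¹, τ]` as a subring of `𝒪(*)`. -/
def Otau : Subalgebra ℂ OY := Algebra.adjoin ℂ {OY.z, OY.t 1, OY.t (-1), OY.tau 1}

/-! ### The rings `ℛ^int` -/

/-- Generators of `ℛ^int`: functions, the symbol `z² ∂_z` and the symbols `z ∂_{x_i}`. -/
inductive RGen (O ι : Type) : Type
  | fn (f : O)
  | dz
  | dx (i : ι)

/-- The defining relations of `ℛ^int = 𝒪⟨z²∂_z, z∂_{x_i}⟩`: functions multiply as in `𝒪`,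
`δ f = f δ + δ(f)` for a derivation `δ` and a function `f`, and
`[z²∂_z, z∂_{x_i}] = z · z∂_{x_i}`, `[z∂_{x_i}, z∂_{x_j}] = 0`. -/
inductive RRel {O ι : Type} [CommRing O] [Algebra ℂ O] (z : O) (Dz : Derivation ℂ O O)
    (Dx : ι → Derivation ℂ O O) :
    FreeAlgebra ℂ (RGen O ι) → FreeAlgebra ℂ (RGen O ι) → Prop
  | fn_algebraMap (c : ℂ) : RRel z Dz Dx (FreeAlgebra.ι ℂ (.fn (algebraMap ℂ O c)))
      (algebraMap ℂ _ c)
  | fn_add (f g : O) : RRel z Dz Dx (FreeAlgebra.ι ℂ (.fn (f + g)))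
      (FreeAlgebra.ι ℂ (.fn f) + FreeAlgebra.ι ℂ (.fn g))
  | fn_mul (f g : O) : RRel z Dz Dx (FreeAlgebra.ι ℂ (.fn (f * g)))
      (FreeAlgebra.ι ℂ (.fn f) * FreeAlgebra.ι ℂ (.fn g))
  | dz_fn (f : O) : RRel z Dz Dx (FreeAlgebra.ι ℂ .dz * FreeAlgebra.ι ℂ (.fn f))
      (FreeAlgebra.ι ℂ (.fn f) * FreeAlgebra.ι ℂ .dz + FreeAlgebra.ι ℂ (.fn (Dz f)))
  | dx_fn (i : ι) (f : O) : RRel z Dz Dx (FreeAlgebra.ι ℂ (.dx i) * FreeAlgebra.ι ℂ (.fn f))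
      (FreeAlgebra.ι ℂ (.fn f) * FreeAlgebra.ι ℂ (.dx i) + FreeAlgebra.ι ℂ (.fn (Dx i f)))
  | dz_dx (i : ι) : RRel z Dz Dx (FreeAlgebra.ι ℂ .dz * FreeAlgebra.ι ℂ (.dx i))
      (FreeAlgebra.ι ℂ (.dx i) * FreeAlgebra.ι ℂ .dz
        + FreeAlgebra.ι ℂ (.fn z) * FreeAlgebra.ι ℂ (.dx i))
  | dx_dx (i j : ι) : RRel z Dz Dx (FreeAlgebra.ι ℂ (.dx i) * FreeAlgebra.ι ℂ (.dx j))
      (FreeAlgebra.ι ℂ (.dx j) * FreeAlgebra.ι ℂ (.dx i))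

/-- The ring `ℛ^int = 𝒪⟨z²∂_z, z∂_{x_i}⟩` of differential operators, for a coordinate `z` and
coordinates `x_i`, where `Dz` is the derivation `z²∂_z` of `𝒪` and `Dx i` is `z∂_{x_i}`. -/
def RInt {O ι : Type} [CommRing O] [Algebra ℂ O] (z : O) (Dz : Derivation ℂ O O)
    (Dx : ι → Derivation ℂ O O) : Type :=
  RingQuot (RRel z Dz Dx)

namespace RInt

variable {O ι : Type} [CommRing O] [Algebra ℂ O] {z : O} {Dz : Derivation ℂ O O}
  {Dx : ι → Derivation ℂ O O}

instance : Ring (RInt z Dz Dx) := inferInstanceAs (Ring (RingQuot (RRel z Dz Dx)))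
instance : Algebra ℂ (RInt z Dz Dx) := inferInstanceAs (Algebra ℂ (RingQuot (RRel z Dz Dx)))

/-- A generator as an element of `ℛ^int`. -/
def gen (x : RGen O ι) : RInt z Dz Dx := RingQuot.mkAlgHom ℂ (RRel z Dz Dx) (FreeAlgebra.ι ℂ x)

/-- The inclusion `𝒪 → ℛ^int`. -/
def fn : O →ₐ[ℂ] RInt z Dz Dx :=
  have hmul (f g : O) : (gen (.fn (f * g)) : RInt z Dz Dx) = gen (.fn f) * gen (.fn g) :=
    (RingQuot.mkAlgHom_rel ℂ (RRel.fn_mul f g)).trans (map_mul _ _ _)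
  have hadd (f g : O) : (gen (.fn (f + g)) : RInt z Dz Dx) = gen (.fn f) + gen (.fn g) :=
    (RingQuot.mkAlgHom_rel ℂ (RRel.fn_add f g)).trans (map_add _ _ _)
  have hc (c : ℂ) : (gen (.fn (algebraMap ℂ O c)) : RInt z Dz Dx) = algebraMap ℂ _ c :=
    (RingQuot.mkAlgHom_rel ℂ (RRel.fn_algebraMap c)).trans (AlgHom.commutes _ _)
  { toFun := fun f => gen (.fn f)
    map_one' := by simpa using hc 1
    map_mul' := hmul
    map_zero' := by simpa using hc 0
    map_add' := hadd
    commutes' := hc }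

/-- The element `z²∂_z`. -/
def dz : RInt z Dz Dx := gen .dz
/-- The element `z∂_{x_i}`. -/
def dx (i : ι) : RInt z Dz Dx := gen (.dx i)

theorem dz_mul_fn (f : O) : (dz * fn f : RInt z Dz Dx) = fn f * dz + fn (Dz f) := by
  have h := RingQuot.mkAlgHom_rel ℂ (RRel.dz_fn (z := z) (Dz := Dz) (Dx := Dx) f)
  rw [map_mul, map_add, map_mul] at h
  exact h

theorem dx_mul_fn (i : ι) (f : O) :
    (dx i * fn f : RInt z Dz Dx) = fn f * dx i + fn (Dx i f) := by
  have h := RingQuot.mkAlgHom_rel ℂ (RRel.dx_fn (z := z) (Dz := Dz) (Dx := Dx) i f)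
  rw [map_mul, map_add, map_mul] at h
  exact h

theorem dz_mul_dx (i : ι) : (dz * dx i : RInt z Dz Dx) = dx i * dz + fn z * dx i := by
  have h := RingQuot.mkAlgHom_rel ℂ (RRel.dz_dx (z := z) (Dz := Dz) (Dx := Dx) i)
  rw [map_mul, map_add, map_mul, map_mul] at h
  exact h

theorem dx_mul_dx (i j : ι) : (dx i * dx j : RInt z Dz Dx) = dx j * dx i := by
  have h := RingQuot.mkAlgHom_rel ℂ (RRel.dx_dx (z := z) (Dz := Dz) (Dx := Dx) i j)
  rw [map_mul, map_mul] at h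
  exact h

/-- An algebra homomorphism out of `ℛ^int` is given by the images of functions, of `z²∂_z` and of
the `z∂_{x_i}`, subject to the defining relations. -/
def lift {A : Type} [Ring A] [Algebra ℂ A] (F : O →ₐ[ℂ] A) (a : A) (b : ι → A)
    (h1 : ∀ f, a * F f = F f * a + F (Dz f)) (h2 : ∀ i f, b i * F f = F f * b i + F (Dx i f))
    (h3 : ∀ i, a * b i = b i * a + F z * b i) (h4 : ∀ i j, b i * b j = b j * b i) :
    RInt z Dz Dx →ₐ[ℂ] A :=
  RingQuot.liftAlgHom ℂ ⟨FreeAlgebra.lift ℂ (fun x => match x with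
    | .fn f => F f
    | .dz => a
    | .dx i => b i), by
      intro x y h
      cases h <;> simp [h1, h2, h3]
      exact h4 _ _⟩

section lift
variable {A : Type} [Ring A] [Algebra ℂ A] (F : O →ₐ[ℂ] A) (a : A) (b : ι → A)
    (h1 : ∀ f, a * F f = F f * a + F (Dz f)) (h2 : ∀ i f, b i * F f = F f * b i + F (Dx i f))
    (h3 : ∀ i, a * b i = b i * a + F z * b i) (h4 : ∀ i j, b i * b j = b j * b i)

theorem lift_fn (f : O) : lift F a b h1 h2 h3 h4 (fn f) = F f :=
  (RingQuot.liftAlgHom_mkAlgHom_apply ℂ _ _ _).trans (FreeAlgebra.lift_ι_apply _ (RGen.fn f))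

theorem lift_dz : lift F a b h1 h2 h3 h4 dz = a :=
  (RingQuot.liftAlgHom_mkAlgHom_apply ℂ _ _ _).trans (FreeAlgebra.lift_ι_apply _ RGen.dz)

theorem lift_dx (i : ι) : lift F a b h1 h2 h3 h4 (dx i) = b i :=
  (RingQuot.liftAlgHom_mkAlgHom_apply ℂ _ _ _).trans (FreeAlgebra.lift_ι_apply _ (RGen.dx i))

end lift

end RInt

/-- `ℛ^int` on `𝒳 = 𝔸¹_z × 𝔾_{m,t}`, that is `𝒪(𝒳)⟨z²∂_z, z∂_t⟩`. -/
abbrev RX : Type := RInt OX.z OX.Dz (fun _ : Unit => OX.Dt)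

/-- The coordinates `t` and `τ`. -/
inductive Coord : Type
  | t
  | tau

/-- The derivations `z∂_t` and `z∂_τ` of `𝒪(*)`. -/
def OY.Dx : Coord → Derivation ℂ OY OY
  | .t => OY.Dt
  | .tau => OY.Dtau

/-- `ℛ^int(*τ=0)` on `𝒳 × 𝔸¹_τ`, that is `𝒪(*)⟨z²∂_z, z∂_t, z∂_τ⟩`. -/
abbrev RY : Type := RInt OY.z OY.Dz OY.Dx

/-- `V₀ℛ = 𝒪(𝒳 × 𝔸¹_τ)⟨z∂_t, zτ∂_τ⟩`. -/
def V0R : Subalgebra ℂ RY :=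
  Algebra.adjoin ℂ
    (RInt.fn '' (Otau : Set OY) ∪
      {RInt.dx Coord.t, RInt.fn (OY.tau 1) * RInt.dx Coord.tau})

/-! ### Rescaling -/

/-- Pull-back of functions along `(z, t, τ) ↦ (zθ, t)`, `θ = τ⁻¹`: `z ↦ z/τ`, `t ↦ t`. -/
def mu : OX →ₐ[ℂ] OY :=
  AddMonoidAlgebra.mapDomainAlgHom ℂ ℂ
    ({ toFun := fun p => (p.1, p.2, -(p.1 : ℤ))
       map_zero' := by simp
       map_add' := fun p q => by ext <;> simp [add_comm] } : ℕ × ℤ →+ ℕ × ℤ × ℤ)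

theorem mu_single (p : ℕ × ℤ) (c : ℂ) :
    mu (AddMonoidAlgebra.single p c) = AddMonoidAlgebra.single (p.1, p.2, -(p.1 : ℤ)) c := by
  simp [mu]

/-- `𝒪(*)` as an algebra over `𝒪(𝒳)` through the rescaling map. -/
instance instAlgebraOXOY : Algebra OX OY := mu.toAlgebra

theorem OX_smul_OY (g : OX) (f : OY) : g • f = mu g * f := rfl

instance : IsScalarTower ℂ OX OY := IsScalarTower.of_algHom mu

/-- The chain rule for `z²∂_z`. -/
theorem Dz_mu (g : OX) : OY.Dz (mu g) = OY.tau 1 * mu (OX.Dz g) := by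
  induction g using AddMonoidAlgebra.induction_linear with
  | zero => simp
  | add x y hx hy => simp only [map_add, hx, hy, mul_add]
  | single m r =>
    simp [OY.Dz, OX.Dz, OY.zdz, OX.zdz, mu_single, euler_single, OY.z, OX.z, OY.tau,
      AddMonoidAlgebra.single_mul_single]

/-- The chain rule for `z∂_t`. -/
theorem Dt_mu (g : OX) : OY.Dt (mu g) = OY.tau 1 * mu (OX.Dt g) := by
  induction g using AddMonoidAlgebra.induction_linear with
  | zero => simp
  | add x y hx hy => simp only [map_add, hx, hy, mul_add]
  | single m r =>
    simp [OY.Dt, OX.Dt, OY.tdt, OX.tdt, mu_single, euler_single, OY.z, OX.z, OY.tau, OY.t, OX.t,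
      AddMonoidAlgebra.single_mul_single]

/-- The chain rule for `z∂_τ`. -/
theorem Dtau_mu (g : OX) : OY.Dtau (mu g) = -1 * mu (OX.Dz g) := by
  induction g using AddMonoidAlgebra.induction_linear with
  | zero => simp
  | add x y hx hy => simp only [map_add, hx, hy, mul_add]
  | single m r =>
    simp [OY.Dtau, OX.Dz, OY.taudtau, OX.zdz, mu_single, euler_single, OY.z, OX.z, OY.tau,
      AddMonoidAlgebra.single_mul_single, add_comm (-1 : ℤ)]

/-- An `ℛ_𝒳^int`-module `N` regarded as a module over `ℂ`, `𝒪(𝒳)` and `ℛ_𝒳^int`. -/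
def Res (N : Type) : Type := N

section Res
variable (N : Type) [AddCommGroup N] [Module RX N]

instance : AddCommGroup (Res N) := inferInstanceAs (AddCommGroup N)
instance : Module RX (Res N) := inferInstanceAs (Module RX N)
instance : Module OX (Res N) := Module.compHom N (RInt.fn : OX →ₐ[ℂ] RX).toRingHom
instance : Module ℂ (Res N) := Module.compHom N (algebraMap ℂ RX)

/-- The identity `N → Res N`. -/
def Res.of : N ≃ₗ[RX] Res N := LinearEquiv.refl RX N

theorem Res.OX_smul {N : Type} [AddCommGroup N] [Module RX N] (g : OX) (m : Res N) :
    g • m = (RInt.fn g : RX) • m := rfl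

instance : IsScalarTower ℂ RX (Res N) :=
  ⟨fun c r m => by
    rw [Algebra.smul_def, mul_smul]; rfl⟩

instance : IsScalarTower ℂ OX (Res N) :=
  ⟨fun c g m => by
    rw [Res.OX_smul, map_smul, smul_assoc, Res.OX_smul]⟩

end Res

section Rescale
variable (N : Type) [AddCommGroup N] [Module RX N]

/-- The rescaling of an `ℛ_𝒳^int`-module `N`, with `τ` inverted: as an `𝒪(*)`-module it is the
pull-back `𝒪(*) ⊗_{𝒪(𝒳)} N` along `(z, t, τ) ↦ (z/τ, t)`. -/
def Rescale : Type := OY ⊗[OX] Res N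

instance : AddCommGroup (Rescale N) := inferInstanceAs (AddCommGroup (OY ⊗[OX] Res N))
instance : Module OY (Rescale N) := inferInstanceAs (Module OY (OY ⊗[OX] Res N))
instance : Module ℂ (Rescale N) := inferInstanceAs (Module ℂ (OY ⊗[OX] Res N))
instance : IsScalarTower ℂ OY (Rescale N) :=
  inferInstanceAs (IsScalarTower ℂ OY (OY ⊗[OX] Res N))

variable {N}

namespace Rescale

/-- The element `f ⊗ m`. -/
def mk (f : OY) (m : Res N) : Rescale N := f ⊗ₜ[OX] m

theorem add_mk (f f' : OY) (m : Res N) : mk (f + f') m = mk f m + mk f' m :=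
  TensorProduct.add_tmul _ _ _
theorem mk_add (f : OY) (m m' : Res N) : mk f (m + m') = mk f m + mk f m' :=
  TensorProduct.tmul_add _ _ _
theorem zero_mk (m : Res N) : mk 0 m = 0 := TensorProduct.zero_tmul _ _
theorem neg_mk (f : OY) (m : Res N) : mk (-f) m = -mk f m := TensorProduct.neg_tmul _ _
theorem smul_mk (g f : OY) (m : Res N) : g • mk f m = mk (g * f) m := rfl
theorem csmul_mk (c : ℂ) (f : OY) (m : Res N) : c • mk f m = mk (c • f) m := rfl
theorem mk_smul (f : OY) (g : OX) (m : Res N) : mk f (g • m) = mk (mu g * f) m :=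
  (TensorProduct.smul_tmul g f m).symm

theorem induction {p : Rescale N → Prop} (zero : p 0) (mk : ∀ f m, p (mk f m))
    (add : ∀ x y, p x → p y → p (x + y)) (x : Rescale N) : p x :=
  TensorProduct.induction_on x zero mk add

end Rescale

open Rescale

/-- The biadditive map `(f, m) ↦ d f ⊗ m + a f ⊗ δ m`. -/
def chainAux (d : Derivation ℂ OY OY) (a : OY) (δ : RX) : OY →+ Res N →+ Rescale N :=
  AddMonoidHom.mk' (fun f => AddMonoidHom.mk'
    (fun m : Res N => mk (d f) m + mk (a * f) (δ • m))
    (fun m m' => by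
      rw [smul_add, mk_add, mk_add]; abel))
    (fun f f' => by
      refine AddMonoidHom.ext fun m => ?_
      simp only [map_add, mul_add, add_mk, AddMonoidHom.mk'_apply, AddMonoidHom.add_apply]
      abel)

theorem chainAux_apply (d : Derivation ℂ OY OY) (a : OY) (δ : RX) (f : OY) (m : Res N) :
    chainAux d a δ f m = mk (d f) m + mk (a * f) (δ • m) := rfl

theorem chainAux_balanced (d : Derivation ℂ OY OY) (a : OY) (D : Derivation ℂ OX OX) (δ : RX)
    (h1 : ∀ g : OX, δ * RInt.fn g = RInt.fn g * δ + RInt.fn (D g))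
    (h2 : ∀ g : OX, d (mu g) = a * mu (D g)) (g : OX) (f : OY) (m : Res N) :
    chainAux d a δ (g • f) m = chainAux d a δ f (g • m) := by
  have e1 : d (mu g * f) = mu g * d f + mu (D g) * (a * f) := by
    rw [Derivation.leibniz, h2, smul_eq_mul, smul_eq_mul]
    ring
  have e2 : δ • (g • m) = g • (δ • m) + (D g) • m := by
    rw [Res.OX_smul, Res.OX_smul, Res.OX_smul, ← mul_smul, h1, add_smul, mul_smul]
  have e3 : a * (mu g * f) = mu g * (a * f) := mul_left_comm _ _ _
  rw [chainAux_apply, chainAux_apply, OX_smul_OY, e1, e2, e3, add_mk, mk_add,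
    mk_smul, mk_smul, mk_smul]
  exact (add_assoc _ _ _).trans (congrArg _ (add_comm _ _))

/-- If `d(μ^* g) = a μ^*(D g)` for functions `g`, and `δ` acts on `N` over the derivation `D`, then
`f ⊗ m ↦ d f ⊗ m + a f ⊗ δ m` is a well-defined operator on the pull-back: the action of `d` given
by the chain rule. -/
def chain (d : Derivation ℂ OY OY) (a : OY) (D : Derivation ℂ OX OX) (δ : RX)
    (h1 : ∀ g : OX, δ * RInt.fn g = RInt.fn g * δ + RInt.fn (D g))
    (h2 : ∀ g : OX, d (mu g) = a * mu (D g)) : Module.End ℂ (Rescale N) :=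
  have F : {F : Rescale N →+ Rescale N // ∀ f m, F (mk f m) = chainAux d a δ f m} :=
    ⟨TensorProduct.liftAddHom (chainAux d a δ) (chainAux_balanced d a D δ h1 h2),
      fun _ _ => rfl⟩
  { toFun := F.1
    map_add' := F.1.map_add
    map_smul' := fun c x => by
      induction x using Rescale.induction with
      | zero => rw [smul_zero, map_zero, smul_zero]
      | add x y hx hy => rw [smul_add, map_add, hx, hy, map_add, smul_add]
      | mk f m =>
        rw [csmul_mk, F.2, F.2, chainAux_apply, chainAux_apply, Derivation.map_smul,
          mul_smul_comm, RingHom.id_apply, smul_add, csmul_mk, csmul_mk] }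

theorem chain_mk (d : Derivation ℂ OY OY) (a : OY) (D : Derivation ℂ OX OX) (δ : RX)
    (h1 : ∀ g : OX, δ * RInt.fn g = RInt.fn g * δ + RInt.fn (D g))
    (h2 : ∀ g : OX, d (mu g) = a * mu (D g)) (f : OY) (m : Res N) :
    chain d a D δ h1 h2 (mk f m) = mk (d f) m + mk (a * f) (δ • m) := rfl

/-- `z²∂_z (f ⊗ m) = z²∂_z f ⊗ m + τ f ⊗ z²∂_z m`. -/
def actDz : Module.End ℂ (Rescale N) :=
  chain OY.Dz (OY.tau 1) OX.Dz RInt.dz RInt.dz_mul_fn Dz_mu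

/-- `z∂_t (f ⊗ m) = z∂_t f ⊗ m + τ f ⊗ z∂_t m` and
`z∂_τ (f ⊗ m) = z∂_τ f ⊗ m - f ⊗ z²∂_z m`. -/
def actDx : Coord → Module.End ℂ (Rescale N)
  | .t => chain OY.Dt (OY.tau 1) OX.Dt (RInt.dx ()) (RInt.dx_mul_fn ()) Dt_mu
  | .tau => chain OY.Dtau (-1) OX.Dz RInt.dz RInt.dz_mul_fn Dtau_mu

/-- Multiplication by functions on the pull-back. -/
def actFn : OY →ₐ[ℂ] Module.End ℂ (Rescale N) := Algebra.lsmul ℂ ℂ (Rescale N)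

theorem actFn_mk (g f : OY) (m : Res N) : actFn g (mk f m) = mk (g * f) m := rfl

theorem chain_actFn (d : Derivation ℂ OY OY) (a : OY) (D : Derivation ℂ OX OX) (δ : RX)
    (h1 : ∀ g : OX, δ * RInt.fn g = RInt.fn g * δ + RInt.fn (D g))
    (h2 : ∀ g : OX, d (mu g) = a * mu (D g)) (f : OY) :
    (chain d a D δ h1 h2 : Module.End ℂ (Rescale N)) * actFn f =
      actFn f * chain d a D δ h1 h2 + actFn (d f) := by
  refine LinearMap.ext fun x => ?_
  induction x using Rescale.induction with
  | zero => simp only [map_zero]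
  | add x y hx hy => rw [map_add, hx, hy, map_add]
  | mk g m =>
    simp only [Module.End.mul_apply, LinearMap.add_apply, actFn_mk, chain_mk, map_add,
      Derivation.leibniz, smul_eq_mul, add_mk]
    rw [mul_comm g (d f), mul_left_comm a f g]
    abel

theorem Dz_Dx (c : Coord) (f : OY) :
    OY.Dz (OY.Dx c f) = OY.Dx c (OY.Dz f) + OY.z * OY.Dx c f := by
  induction f using AddMonoidAlgebra.induction_linear with
  | zero => simp
  | add x y hx hy => simp only [map_add, hx, hy, mul_add]; abel
  | single p r =>
    cases c <;>
    · simp [OY.Dx, OY.Dz, OY.Dt, OY.Dtau, OY.zdz, OY.tdt, OY.taudtau, euler_single, OY.z, OY.t,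
        OY.tau, AddMonoidAlgebra.single_mul_single, ← AddMonoidAlgebra.single_add, ← add_assoc]
      ring

theorem Dt_Dtau (f : OY) : OY.Dt (OY.Dtau f) = OY.Dtau (OY.Dt f) := by
  induction f using AddMonoidAlgebra.induction_linear with
  | zero => simp
  | add x y hx hy => simp only [map_add, hx, hy]
  | single p r =>
    simp [OY.Dt, OY.Dtau, OY.tdt, OY.taudtau, euler_single, OY.z, OY.t,
      OY.tau, AddMonoidAlgebra.single_mul_single, ← add_assoc]
    ring

theorem Dx_t_tau : OY.Dx .t (OY.tau 1) = 0 := by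
  simp [OY.Dx, OY.Dt, OY.tdt, euler_single, OY.tau]

theorem Dx_tau_tau : OY.Dx .tau (OY.tau 1) = OY.z := by
  simp [OY.Dx, OY.Dtau, OY.taudtau, euler_single, OY.tau, OY.z,
    AddMonoidAlgebra.single_mul_single]

theorem Dz_tau : OY.Dz (OY.tau 1) = 0 := by
  simp [OY.Dz, OY.zdz, euler_single, OY.tau]

theorem tau_mul_mu_z : OY.tau 1 * mu OX.z = OY.z := by
  simp [OY.tau, OY.z, OX.z, mu_single, AddMonoidAlgebra.single_mul_single]

theorem actDz_actDx (c : Coord) :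
    (actDz * actDx c : Module.End ℂ (Rescale N)) = actDx c * actDz + actFn OY.z * actDx c := by
  refine LinearMap.ext fun x => ?_
  induction x using Rescale.induction with
  | zero => simp only [map_zero]
  | add x y hx hy => rw [map_add, hx, hy, map_add]
  | mk f m =>
    have hD := Dz_Dx c f
    cases c with
    | t =>
      have hm : (RInt.dz : RX) • (RInt.dx () : RX) • m =
          (RInt.dx () : RX) • (RInt.dz : RX) • m + OX.z • (RInt.dx () : RX) • m := by
        rw [Res.OX_smul, ← mul_smul, ← mul_smul, ← mul_smul, ← add_smul, RInt.dz_mul_dx]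
      have h0 : OY.Dt (OY.tau 1) = 0 := Dx_t_tau
      have hz : mu OX.z * (OY.tau 1 * (OY.tau 1 * f)) = OY.z * (OY.tau 1 * f) := by
        rw [← mul_assoc, mul_comm (mu _), tau_mul_mu_z]
      simp only [OY.Dx] at hD
      simp only [Module.End.mul_apply, LinearMap.add_apply, actDz, actDx, actFn_mk, chain_mk,
        map_add, Derivation.leibniz, smul_eq_mul, add_mk, hm, hD, Dz_tau, h0,
        mk_add, mul_zero, add_zero, mk_smul, hz]
      abel
    | tau =>
      have h0 : OY.Dtau (OY.tau 1) = OY.z := Dx_tau_tau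
      simp only [OY.Dx] at hD
      simp only [Module.End.mul_apply, LinearMap.add_apply, actDz, actDx, actFn_mk, chain_mk,
        map_add, Derivation.leibniz, smul_eq_mul, add_mk, hD, h0,
        neg_mul, one_mul, map_neg, neg_mk]
      rw [mul_comm f OY.z]
      abel

theorem actDx_t_tau :
    (actDx .t * actDx .tau : Module.End ℂ (Rescale N)) = actDx .tau * actDx .t := by
  refine LinearMap.ext fun x => ?_
  induction x using Rescale.induction with
  | zero => simp only [map_zero]
  | add x y hx hy => rw [map_add, hx, hy, map_add]
  | mk f m =>
    have hD := Dt_Dtau f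
    have hm : (RInt.dz : RX) • (RInt.dx () : RX) • m =
        (RInt.dx () : RX) • (RInt.dz : RX) • m + OX.z • (RInt.dx () : RX) • m := by
      rw [Res.OX_smul, ← mul_smul, ← mul_smul, ← mul_smul, ← add_smul, RInt.dz_mul_dx]
    have h0 : OY.Dtau (OY.tau 1) = OY.z := Dx_tau_tau
    have hz : mu OX.z * (OY.tau 1 * f) = OY.z * f := by
      rw [← mul_assoc, mul_comm (mu _), tau_mul_mu_z]
    simp only [Module.End.mul_apply, actDx, chain_mk,
      map_add, Derivation.leibniz, smul_eq_mul, add_mk, hm, hD, h0,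
      neg_mul, one_mul, map_neg, neg_mk,
      mk_add]
    rw [mk_smul (OY.tau 1 * f) OX.z, hz]
    rw [mul_comm f OY.z]
    abel

theorem actDz_actFn (f : OY) : (actDz : Module.End ℂ (Rescale N)) * actFn f =
    actFn f * actDz + actFn (OY.Dz f) :=
  chain_actFn OY.Dz (OY.tau 1) OX.Dz RInt.dz RInt.dz_mul_fn Dz_mu f

theorem actDx_actFn (c : Coord) (f : OY) : (actDx c : Module.End ℂ (Rescale N)) * actFn f =
    actFn f * actDx c + actFn (OY.Dx c f) :=
  match c with
  | .t => chain_actFn OY.Dt (OY.tau 1) OX.Dt (RInt.dx ()) (RInt.dx_mul_fn ()) Dt_mu f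
  | .tau => chain_actFn OY.Dtau (-1) OX.Dz RInt.dz RInt.dz_mul_fn Dtau_mu f

theorem actDx_actDx (c c' : Coord) :
    (actDx c * actDx c' : Module.End ℂ (Rescale N)) = actDx c' * actDx c :=
  match c, c' with
  | .t, .t => rfl
  | .t, .tau => actDx_t_tau
  | .tau, .t => actDx_t_tau.symm
  | .tau, .tau => rfl

/-- The action of `ℛ^int(*τ=0)` on the rescaling of an `ℛ_𝒳^int`-module. -/
def act : RY →ₐ[ℂ] Module.End ℂ (Rescale N) :=
  RInt.lift (A := Module.End ℂ (Rescale N)) actFn actDz actDx actDz_actFn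
    actDx_actFn actDz_actDx actDx_actDx

instance : Module RY (Rescale N) := Module.compHom (Rescale N) (act (N := N)).toRingHom

theorem fn_smul_mk (g f : OY) (m : Res N) :
    (RInt.fn g : RY) • (mk f m : Rescale N) = mk (g * f) m := by
  change act (RInt.fn g) (mk f m) = _
  rw [act, RInt.lift_fn, actFn_mk]

theorem dz_smul_mk (f : OY) (m : Res N) :
    (RInt.dz : RY) • (mk f m : Rescale N) =
      mk (OY.Dz f) m + mk (OY.tau 1 * f) ((RInt.dz : RX) • m) := by
  change act RInt.dz (mk f m) = _
  rw [act, RInt.lift_dz, actDz, chain_mk]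

theorem dt_smul_mk (f : OY) (m : Res N) :
    (RInt.dx Coord.t : RY) • (mk f m : Rescale N) =
      mk (OY.Dt f) m + mk (OY.tau 1 * f) ((RInt.dx () : RX) • m) := by
  change act (RInt.dx Coord.t) (mk f m) = _
  rw [act, RInt.lift_dx, actDx, chain_mk]

theorem dtau_smul_mk (f : OY) (m : Res N) :
    (RInt.dx Coord.tau : RY) • (mk f m : Rescale N) =
      mk (OY.Dtau f) m + mk (-1 * f) ((RInt.dz : RX) • m) := by
  change act (RInt.dx Coord.tau) (mk f m) = _
  rw [act, RInt.lift_dx, actDx, chain_mk]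

end Rescale

/-! ### The canonical `V`-filtration along `τ = 0` -/

/-- Coherence of a left module: it is finitely generated and all its finitely generated submodules
are finitely presented. -/
def IsCoherentModule (A M : Type) [Ring A] [AddCommGroup M] [Module A M] : Prop :=
  Module.Finite A M ∧ ∀ S : Submodule A M, S.FG → Module.FinitePresentation A S

section VFiltration
variable {M : Type} [AddCommGroup M] [Module RY M]

/-- `V_{<a} = ⋃_{b<a} V_b`. -/
def VLt (V : ℝ → Submodule V0R M) (a : ℝ) : Submodule V0R M := ⨆ b : Set.Iio a, V b

/-- The properties that characterize the canonical `V`-filtration along `τ = 0` of a strictly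
`ℝ`-specializable `ℛ(*τ=0)`-module `M`. -/
structure IsVFiltration (V : ℝ → Submodule V0R M) : Prop where
  mono : Monotone V
  exhaustive : ∀ m : M, ∃ a, m ∈ V a
  /-- Indexing: `V_a = V_{a+ε}` for small `ε`, and the set of jumps is discrete. -/
  rightCont : ∀ a, ∃ ε > 0, V (a + ε) = V a
  jumps : ∀ a b, {c ∈ Set.Icc a b | VLt V c ≠ V c}.Finite
  coherent : ∀ a, IsCoherentModule V0R (V a)
  /-- `τ V_a = V_{a-1}` -/
  tau_smul : ∀ a (m : M), m ∈ V (a - 1) ↔ ∃ m' ∈ V a, m = (RInt.fn (OY.tau 1) : RY) • m'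
  /-- `z∂_τ V_a ⊆ V_{a+1}` -/
  dtau_smul : ∀ a, ∀ m ∈ V a, (RInt.dx Coord.tau : RY) • m ∈ V (a + 1)
  /-- `Gr_a = V_a / V_{<a}` is strict, i.e. flat (equivalently, torsion-free) over `ℂ[z]`. -/
  strict : ∀ a, ∀ p : Polynomial ℂ, p ≠ 0 → ∀ m ∈ V a,
    (RInt.fn (Polynomial.aeval OY.z p) : RY) • m ∈ VLt V a → m ∈ VLt V a
  /-- `zτ∂_τ + a z` is nilpotent on `Gr_a`. -/
  nilpotent : ∀ a, ∃ N : ℕ, ∀ m ∈ V a,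
    ((RInt.fn (OY.tau 1) * RInt.dx Coord.tau + RInt.fn ((a : ℂ) • OY.z) : RY) ^ N) • m ∈ VLt V a

variable (M) in
/-- Strict `ℝ`-specializability along `τ = 0`. -/
def IsStrictlyRSpecializable : Prop := ∃ V : ℝ → Submodule V0R M, IsVFiltration V

end VFiltration

/-! ### The hypergeometric module and its rescaling -/

section Hyp
variable {n : ℕ} (α : Fin n → ℝ) (γ : ℝ)

/-- `P = z²∂_z + n z t∂_t + γ z`. -/
def opP (n : ℕ) (γ : ℝ) : RX :=
  RInt.dz + RInt.fn ((n : ℂ) • OX.t 1) * RInt.dx () + RInt.fn ((γ : ℂ) • OX.z)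

/-- `H = ∏_{i=1}^n z (t∂_t - α_i) - t`. -/
def opH : RX :=
  (List.ofFn fun i : Fin n =>
    RInt.fn (OX.t 1) * RInt.dx () - RInt.fn ((α i : ℂ) • OX.z)).prod - RInt.fn (OX.t 1)

/-- The hypergeometric module `ℛ_𝒳^int / (P, H)` (quotient by the left ideal). -/
abbrev Hhat : Type := RX ⧸ Submodule.span RX {opP n γ, opH α}

/-- The rescaled module `^τĤ`. -/
abbrev tauHhat : Type := Rescale (Hhat α γ)

/-- The class of `1` in `^τĤ`. -/
def genOne : tauHhat α γ :=
  Rescale.mk 1 (Res.of (Hhat α γ) (Submodule.Quotient.mk 1))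

/-- The operator `Q_k = (-n)^k ∏_{j=1}^k (z/τ)(t∂_t - α_j)`. -/
def opQ (k : Fin n) : RY :=
  (-(n : ℂ)) ^ (k : ℕ) •
    (((List.ofFn fun j : Fin n =>
      RInt.fn (OY.tau (-1)) *
        (RInt.fn (OY.t 1) * RInt.dx Coord.t - RInt.fn ((α j : ℂ) • OY.z))).take k).prod : RY)

/-- The class of `τ^ν Q_k` in `^τĤ`. -/
def tauQ (ν : ℤ) (k : Fin n) : tauHhat α γ :=
  (RInt.fn (OY.tau ν) * opQ α k) • genOne α γ

/-- `^τU_a`: the sums `∑_k f_k τ^{ν_k} Q_k` with `f_k` in `𝒪(𝒳 × 𝔸¹_τ)` and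
`max_k (k - n α_{k+1} - γ - ν_k) ≤ a`. -/
def tauU (a : ℝ) : Set (tauHhat α γ) :=
  {m | ∃ (f : Fin n → Otau) (ν : Fin n → ℤ),
    (∀ k : Fin n, (k : ℝ) - n * α k - γ - ν k ≤ a) ∧
    m = ∑ k, (RInt.fn (f k : OY) : RY) • tauQ α γ (ν k) k}

/-- `ν_a(k) = ⌈-a + k - γ - n α_{k+1}⌉`. -/
def nu (a : ℝ) (k : Fin n) : ℤ := ⌈-a + k - γ - n * α k⌉

end Hyp

end IrrHodge

end

/-! Existence. The hypergeometric module is free over `ℂ[z, t, t⁻¹]` on the classes `q_k` of `∏_{j ≤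
k} z(t∂_t - α_j)`, `0 ≤ k < n`. They generate because `P` gives `P q_k = k z q_k` and `H` gives `q_n
= t q_0`, so their span is stable under all operators (`mem_span_hypq`). They are independent
because the module maps to an explicit one on `ℂ[z, s, s⁻¹]`, `t = sⁿ`, sending `q_k` to `s^k`
(`eq_zero_of_sum_smul_hypq`).

Put `e_k = 1 ⊗ q_k`, so that `Q_k = (-n)^k e_k`, and let `ord_k = k - γ - n α_{k+1}`. The chain rule
gives `zτ∂_τ e_k = n τ e_{k+1} - ord_k z e_k`, with `e_n = t e_0`. Give `τ^ν e_k` the order `ord_k -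
ν`; then `^τU_a` is spanned over `ℂ[z, t, t⁻¹]` by the `τ^ν e_k` of order at most `a`. The operator
`zτ∂_τ + a z` multiplies `τ^ν e_k` by `(a - order) z`, which vanishes when the order is `a`, and
adds `n τ^{ν+1} e_{k+1}`. The order of the added term is no larger because `α` is monotone, and
drops strictly on passing from `e_{n-1}` to `e_n = t e_0` because `α_n < α_1 + 1`. So `n`
applications lead from `U_a` into `U_{<a}` (`thetaShift_smul_mem`). Strictness is read off
coordinates in the basis, and coherence holds because `U_a` is finite over the Noetherian ring `𝒪`,
which together with two operators acting by derivations generates `V₀ℛ`.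

Uniqueness (`IsVFiltration.le`). Let `V`, `W` be canonical and `m ∈ V_a`. Products of operators
`zτ∂_τ + c z` with `c ≤ a` push `m` arbitrarily far down in `V`, hence in `W`, as the two
filtrations are comparable up to a shift. These operators are injective on `Gr_b^W` for `b > a`,
since there they differ from a nilpotent operator by a nonzero multiple of the nonzerodivisor `z`.
Hence `m` has zero class in every such `Gr_b^W`, and so `m ∈ W_a`. -/

noncomputable section

namespace IrrHodge

/-! ### Coherence over rings of differential operators -/

section Coherence
variable {A O ι N : Type} [Ring A] [CommRing O] [IsNoetherianRing O] [Finite ι]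
  [AddCommGroup N] [Module A N]

/-- A module over a ring generated by a Noetherian ring `O` and finitely many elements `δ j`
commuting with `O` up to derivations is finitely presented as soon as it is finite over `O`. -/
theorem finitePresentation_of_finite_restrict (i : O →+* A) (δ : ι → A) (d : ι → O → O)
    (hδ : ∀ j f, δ j * i f = i f * δ j + i (d j f))
    (hgen : Subring.closure (Set.range i ∪ Set.range δ) = ⊤)
    (hfin : ∃ (m : ℕ) (s : Fin m → N), ∀ x, ∃ w : Fin m → O, x = ∑ k, i (w k) • s k) :
    Module.FinitePresentation A N := by
  classical
  obtain ⟨m, s, hs⟩ := hfin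
  let : Module O N := Module.compHom N i
  let l : (Fin m → A) →ₗ[A] N := Fintype.linearCombination A s
  let lO : (Fin m → O) →ₗ[O] N := Fintype.linearCombination O s
  have l_apply : ∀ v, l v = ∑ k, v k • s k := fun v => Fintype.linearCombination_apply A s v
  let I : (Fin m → O) →+ (Fin m → A) := i.toAddMonoidHom.compLeft (Fin m)
  have I_apply : ∀ w k, I w k = i (w k) := fun _ _ => rfl
  have lI : ∀ w, l (I w) = lO w := fun w => by
    rw [l_apply]
    exact (Fintype.linearCombination_apply O s w).symm
  have I_smul : ∀ (f : O) w, I (f • w) = i f • I w := fun f w => by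
    ext k
    simp [I_apply]
  -- Two finite families of relations suffice: the `O`-linear syzygies `R₀` of the generators, and
  -- `rel`, which rewrites each `δ j • s k` as an `O`-combination of the generators.
  obtain ⟨R₀, hR₀⟩ := (isNoetherian_def.mp inferInstance : ∀ S : Submodule O (Fin m → O), S.FG)
    (LinearMap.ker lO)
  choose c hc using fun p : ι × Fin m => hs (δ p.1 • s p.2)
  let rel : ι × Fin m → Fin m → A := fun p => Pi.single p.2 (δ p.1) - I (c p)
  let K : Submodule A (Fin m → A) := Submodule.span A (I '' R₀ ∪ Set.range rel)
  have hIK : ∀ w ∈ LinearMap.ker lO, I w ∈ K := by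
    intro w hw
    rw [← hR₀] at hw
    induction hw using Submodule.span_induction with
    | mem x h => exact Submodule.subset_span (Or.inl ⟨x, h, rfl⟩)
    | zero => rw [map_zero]; exact K.zero_mem
    | add x y _ _ hx hy => rw [map_add]; exact K.add_mem hx hy
    | smul a x _ hx => rw [I_smul]; exact K.smul_mem _ hx
  have hKl : K ≤ LinearMap.ker l := by
    refine Submodule.span_le.mpr ?_
    rintro _ (⟨w, hw, rfl⟩ | ⟨p, rfl⟩)
    · have : w ∈ LinearMap.ker lO := hR₀ ▸ Submodule.subset_span hw
      simpa [lI] using this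
    · have e1 : l (Pi.single p.2 (δ p.1)) = δ p.1 • s p.2 := by
        simp [l_apply, Pi.single_apply, ite_smul]
      have e2 : l (I (c p)) = δ p.1 • s p.2 := by
        rw [l_apply, hc p]
        rfl
      simp [rel, e1, e2]
  -- Modulo `K`, applying `A` to a vector with coefficients in `O` gives again such a vector: this
  -- is the commutation rule followed by `rel`. A relation over `A` thereby reduces to one over `O`,
  -- which `R₀` generates.
  have key : ∀ a : A, ∀ w, ∃ w', a • I w - I w' ∈ K := by
    intro a
    have ha : a ∈ Subring.closure (Set.range i ∪ Set.range δ) := hgen ▸ Subring.mem_top a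
    induction ha using Subring.closure_induction with
    | mem x h =>
      rcases h with ⟨f, rfl⟩ | ⟨j, rfl⟩
      · intro w
        exact ⟨f • w, by rw [I_smul, sub_self]; exact K.zero_mem⟩
      · intro w
        refine ⟨∑ k, w k • c (j, k) + fun k => d j (w k), ?_⟩
        have : δ j • I w - I (∑ k, w k • c (j, k) + fun k => d j (w k)) =
            ∑ k, i (w k) • rel (j, k) := by
          rw [map_add, map_sum]
          simp only [rel, smul_sub, Finset.sum_sub_distrib, I_smul]
          rw [sub_add_eq_sub_sub_swap]
          congr 1
          ext k
          simp [I_apply, hδ, Finset.sum_apply, Pi.single_apply]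
        rw [this]
        exact K.sum_mem fun k _ => K.smul_mem _ (Submodule.subset_span (Or.inr ⟨_, rfl⟩))
    | zero => exact fun w => ⟨0, by simp⟩
    | one => exact fun w => ⟨w, by simp⟩
    | add x y _ _ hx hy =>
      intro w
      obtain ⟨w₁, h₁⟩ := hx w
      obtain ⟨w₂, h₂⟩ := hy w
      refine ⟨w₁ + w₂, ?_⟩
      have : (x + y) • I w - I (w₁ + w₂) = (x • I w - I w₁) + (y • I w - I w₂) := by
        rw [map_add, add_smul]; abel
      exact this ▸ K.add_mem h₁ h₂
    | neg x _ hx =>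
      intro w
      obtain ⟨w₁, h₁⟩ := hx w
      refine ⟨-w₁, ?_⟩
      have : -x • I w - I (-w₁) = -(x • I w - I w₁) := by
        rw [map_neg, neg_smul]; abel
      exact this ▸ K.neg_mem h₁
    | mul x y _ _ hx hy =>
      intro w
      obtain ⟨w₁, h₁⟩ := hy w
      obtain ⟨w₂, h₂⟩ := hx w₁
      refine ⟨w₂, ?_⟩
      have : (x * y) • I w - I w₂ = x • (y • I w - I w₁) + (x • I w₁ - I w₂) := by
        rw [mul_smul, smul_sub]; abel
      exact this ▸ K.add_mem (K.smul_mem _ h₁) h₂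
  have hred : ∀ v, ∃ w, v - I w ∈ K := by
    intro v
    choose w hw using fun k => key (v k) (Pi.single k 1)
    refine ⟨∑ k, w k, ?_⟩
    have : v - I (∑ k, w k) = ∑ k, (v k • I (Pi.single k 1) - I (w k)) := by
      rw [Finset.sum_sub_distrib, map_sum]
      congr 1
      ext k
      simp [I_apply, Pi.single_apply, Finset.sum_apply, apply_ite i]
    exact this ▸ K.sum_mem fun k _ => hw k
  have hker : LinearMap.ker l = K := by
    refine le_antisymm (fun v hv => ?_) hKl
    obtain ⟨w, hw⟩ := hred v
    have h0 : lO w = 0 := by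
      have := hKl hw
      rw [LinearMap.mem_ker, map_sub, LinearMap.mem_ker.mp hv, zero_sub, neg_eq_zero, lI] at this
      exact this
    simpa using K.add_mem hw (hIK w h0)
  refine Module.finitePresentation_of_surjective l (fun x => ?_) ?_
  · obtain ⟨w, hw⟩ := hs x
    exact ⟨I w, by rw [l_apply, hw]; rfl⟩
  · rw [hker]
    exact Submodule.fg_span ((R₀.finite_toSet.image _).union (Set.finite_range _))

/-- Over such a ring, a module that is finite over `O` is coherent. -/
theorem isCoherentModule_of_finite_restrict (i : O →+* A) (δ : ι → A) (d : ι → O → O)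
    (hδ : ∀ j f, δ j * i f = i f * δ j + i (d j f))
    (hgen : Subring.closure (Set.range i ∪ Set.range δ) = ⊤)
    (hfin : ∃ (m : ℕ) (s : Fin m → N), ∀ x, ∃ w : Fin m → O, x = ∑ k, i (w k) • s k) :
    IsCoherentModule A N := by
  have hN := finitePresentation_of_finite_restrict i δ d hδ hgen hfin
  refine ⟨inferInstance, fun S _ => finitePresentation_of_finite_restrict i δ d hδ hgen ?_⟩
  let : Module O N := Module.compHom N i
  have smul_def : ∀ (f : O) (x : N), f • x = i f • x := fun _ _ => rfl
  obtain ⟨m, s, hs⟩ := hfin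
  have : Module.Finite O N := by
    refine ⟨Submodule.fg_iff_exists_fin_generating_family.mpr ⟨m, s, ?_⟩⟩
    refine eq_top_iff.mpr fun x _ => ?_
    obtain ⟨w, rfl⟩ := hs x
    exact Submodule.sum_mem _ fun k _ =>
      Submodule.smul_mem _ (w k) (Submodule.subset_span ⟨k, rfl⟩)
  -- An `A`-submodule is an `O`-submodule of a Noetherian `O`-module, hence finite over `O`, so the
  -- previous theorem applies to it as well.
  let S' : Submodule O N :=
    { S.toAddSubmonoid with smul_mem' := fun f x hx => S.smul_mem (i f) hx }
  have hS' : S'.FG := isNoetherian_def.mp (isNoetherian_of_isNoetherianRing_of_finite O N) S'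
  obtain ⟨m', s', hs'⟩ := Submodule.fg_iff_exists_fin_generating_family.mp hS'
  have hmem : ∀ k, s' k ∈ S := fun k => by
    change s' k ∈ S'
    rw [← hs']
    exact Submodule.subset_span ⟨k, rfl⟩
  refine ⟨m', fun k => ⟨s' k, hmem k⟩, fun x => ?_⟩
  have hx : (x : N) ∈ Submodule.span O (Set.range s') := hs' ▸ x.2
  obtain ⟨w, hw⟩ := (Submodule.mem_span_range_iff_exists_fun O).mp hx
  refine ⟨w, Subtype.ext ?_⟩
  rw [← hw]
  simp [smul_def]

end Coherence

/-! ### Uniqueness of the canonical `V`-filtration -/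

/-- The operator `zτ∂_τ + a z`. -/
def thetaShift (a : ℝ) : RY :=
  RInt.fn (OY.tau 1) * RInt.dx Coord.tau + RInt.fn ((a : ℂ) • OY.z)

theorem OY.tau_zero : OY.tau 0 = 1 := rfl

theorem OY.tau_mul_tau (a b : ℤ) : OY.tau a * OY.tau b = OY.tau (a + b) := by
  simp [OY.tau, AddMonoidAlgebra.single_mul_single]

theorem OY.z_mem_Otau : OY.z ∈ Otau := Algebra.subset_adjoin (by simp)

theorem fn_mem_V0R {f : OY} (hf : f ∈ Otau) : (RInt.fn f : RY) ∈ V0R :=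
  Algebra.subset_adjoin (Or.inl ⟨f, hf, rfl⟩)

theorem thetaShift_mem_V0R (a : ℝ) : thetaShift a ∈ V0R :=
  V0R.add_mem (Algebra.subset_adjoin (by simp))
    (fn_mem_V0R (Otau.smul_mem OY.z_mem_Otau _))

theorem theta_commute_z : Commute (RInt.fn (OY.tau 1) * RInt.dx Coord.tau : RY)
    (RInt.fn OY.z) := by
  have h0 : OY.Dx Coord.tau OY.z = 0 := by
    simp [OY.Dx, OY.Dtau, OY.taudtau, euler_single, OY.z]
  change _ * _ = _ * _
  rw [mul_assoc, RInt.dx_mul_fn, h0, map_zero, add_zero, ← mul_assoc, ← mul_assoc, ← map_mul,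
    ← map_mul, mul_comm OY.z]

theorem fn_smul_z (c : ℂ) : (RInt.fn (c • OY.z) : RY) = c • RInt.fn OY.z := map_smul _ _ _

theorem thetaShift_sub (a b : ℝ) :
    thetaShift a - thetaShift b = ((a - b : ℝ) : ℂ) • (RInt.fn OY.z : RY) := by
  simp only [thetaShift, fn_smul_z]
  push_cast
  rw [sub_smul]
  abel

theorem thetaShift_commute_z (a : ℝ) : Commute (thetaShift a) (RInt.fn OY.z) := by
  rw [thetaShift, fn_smul_z]
  exact theta_commute_z.add_left ((Commute.refl _).smul_left _)

section
variable {M : Type} [AddCommGroup M] [Module RY M]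

theorem smul_mem_of_mem_V0R {r : RY} (hr : r ∈ V0R) (S : Submodule V0R M) {m : M} (hm : m ∈ S) :
    r • m ∈ S :=
  S.smul_mem (⟨r, hr⟩ : V0R) hm

theorem mem_VLt {V : ℝ → Submodule V0R M} (hV : Monotone V) {a : ℝ} {m : M} :
    m ∈ VLt V a ↔ ∃ b < a, m ∈ V b := by
  have : Nonempty (Set.Iio a) := ⟨⟨a - 1, by simp⟩⟩
  rw [VLt, Submodule.mem_iSup_of_directed]
  · simp
  · exact (hV.comp (Subtype.mono_coe _)).directed_le

namespace IsVFiltration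
variable {V W : ℝ → Submodule V0R M}

theorem tau_smul_mem_iff (hV : IsVFiltration V) (j : ℤ) (a : ℝ) (m : M) :
    (RInt.fn (OY.tau j) : RY) • m ∈ V (a - j) ↔ m ∈ V a := by
  have hone : ∀ (a : ℝ) (m : M), (RInt.fn (OY.tau 1) : RY) • m ∈ V (a - 1) ↔ m ∈ V a := by
    intro a m
    rw [hV.tau_smul]
    refine ⟨fun ⟨m', hm', h⟩ => ?_, fun h => ⟨m, h, rfl⟩⟩
    have := congrArg (fun x => (RInt.fn (OY.tau (-1)) : RY) • x) h
    simp only [← mul_smul, ← map_mul, OY.tau_mul_tau] at this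
    simp only [neg_add_cancel, OY.tau_zero, map_one, one_smul] at this
    exact this ▸ hm'
  have hsucc : ∀ (j : ℤ) (a : ℝ) (m : M), (RInt.fn (OY.tau (j + 1)) : RY) • m ∈ V (a - (j + 1 : ℤ))
      ↔ (RInt.fn (OY.tau j) : RY) • m ∈ V (a - j) := by
    intro j a m
    rw [← hone (a - j), ← mul_smul, ← map_mul, OY.tau_mul_tau, add_comm 1 j]
    push_cast
    rw [sub_add_eq_sub_sub]
  induction j using Int.induction_on with
  | zero => simp [OY.tau_zero]
  | succ k ih => exact (hsucc k a m).trans ih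
  | pred k ih =>
    rw [← hsucc, sub_add_cancel]
    exact ih

/-- Two canonical `V`-filtrations are contained in each other up to a shift. -/
theorem exists_le_shift (hV : IsVFiltration V) (hW : IsVFiltration W) :
    ∃ K : ℝ, ∀ a, V a ≤ W (a + K) := by
  have hfg : (V 0).FG := Module.Finite.iff_fg.mp (hV.coherent 0).1
  obtain ⟨S, hS⟩ := hfg
  choose b hb using hW.exhaustive
  obtain ⟨K, hK⟩ := (S.finite_toSet.image b).bddAbove
  have h0 : V 0 ≤ W K := by
    rw [← hS]
    exact Submodule.span_le.mpr fun m hm => hW.mono (hK ⟨m, hm, rfl⟩) (hb m)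
  -- `K` handles integral indices after translation by a power of `τ`; the extra `1` absorbs
  -- rounding `a` up to `⌈a⌉`.
  refine ⟨K + 1, fun a m hm => ?_⟩
  have h1 : m ∈ V (⌈a⌉ : ℤ) := hV.mono (Int.le_ceil a) hm
  rw [← hV.tau_smul_mem_iff ⌈a⌉, sub_self] at h1
  have h2 : m ∈ W (K + (⌈a⌉ : ℤ)) := by
    rw [← hW.tau_smul_mem_iff ⌈a⌉, add_sub_cancel_right]
    exact h0 h1
  exact hW.mono (by linarith [Int.ceil_lt_add_one a]) h2

theorem thetaShift_nilpotent (hV : IsVFiltration V) (a : ℝ) :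
    ∃ N : ℕ, ∀ m ∈ V a, thetaShift a ^ N • m ∈ VLt V a := hV.nilpotent a

/-- For `a ≠ b` the operator `zτ∂_τ + a z` is injective on `Gr_b`. -/
theorem mem_VLt_of_thetaShift_smul (hV : IsVFiltration V) {a b : ℝ} (hab : a ≠ b) {m : M}
    (hm : m ∈ V b) (h : thetaShift a • m ∈ VLt V b) : m ∈ VLt V b := by
  obtain ⟨N, hN⟩ := hV.thetaShift_nilpotent b
  set c : ℂ := ((b - a : ℝ) : ℂ) with hc
  have hc0 : c ≠ 0 := Complex.ofReal_ne_zero.mpr (sub_ne_zero.mpr hab.symm)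
  set p : Polynomial ℂ := Polynomial.C c * Polynomial.X
  have hp : (RInt.fn (Polynomial.aeval OY.z p) : RY) = c • RInt.fn OY.z := by
    rw [map_mul, Polynomial.aeval_C, Polynomial.aeval_X, ← Algebra.smul_def, fn_smul_z]
  have hmem : (c • RInt.fn OY.z : RY) ∈ V0R := V0R.smul_mem (fn_mem_V0R OY.z_mem_Otau) c
  -- Since `thetaShift b = thetaShift a + c z` with `c = b - a`, and `thetaShift a` kills the class
  -- of `m`, powers of `thetaShift b` act on that class as powers of `c z`.
  have hpow : ∀ j : ℕ, thetaShift b ^ j • m - (c • RInt.fn OY.z : RY) ^ j • m ∈ VLt V b := by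
    intro j
    induction j with
    | zero => simp
    | succ j ih =>
      have e : thetaShift b = thetaShift a + c • (RInt.fn OY.z : RY) := by
        rw [hc, ← thetaShift_sub]; abel
      have hcomm : Commute (thetaShift a) ((c • RInt.fn OY.z : RY) ^ j) :=
        ((thetaShift_commute_z a).smul_right c).pow_right j
      have : thetaShift b ^ (j + 1) • m - (c • RInt.fn OY.z : RY) ^ (j + 1) • m =
          thetaShift b • (thetaShift b ^ j • m - (c • RInt.fn OY.z : RY) ^ j • m) +
            (c • RInt.fn OY.z : RY) ^ j • thetaShift a • m := by
        have h1 : thetaShift b * (c • RInt.fn OY.z : RY) ^ j =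
            (c • RInt.fn OY.z : RY) ^ j * thetaShift a + (c • RInt.fn OY.z : RY) ^ (j + 1) := by
          rw [e, add_mul, hcomm.eq, pow_succ']
        simp only [smul_sub, ← mul_smul]
        rw [h1, add_smul, ← pow_succ']
        abel
      rw [this]
      exact add_mem (smul_mem_of_mem_V0R (thetaShift_mem_V0R b) _ ih)
        (smul_mem_of_mem_V0R (V0R.pow_mem hmem j) _ h)
  -- Nilpotency now says that `(c z)^N` kills the class of `m`, so strictness applies to the
  -- polynomial `(c X)^N`.
  refine hV.strict b (p ^ N) (pow_ne_zero _ ?_) m hm ?_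
  · exact mul_ne_zero (Polynomial.C_ne_zero.mpr hc0) Polynomial.X_ne_zero
  · rw [map_pow, map_pow, hp]
    have := sub_mem (hN m hm) (hpow N)
    simpa using this

/-- If membership in `V b` improves to membership in `V_{<b}` for `b > a`, then it holds down to
`a`. -/
theorem mem_of_forall_lt (hV : IsVFiltration V) {P : M → Prop} {a : ℝ}
    (hP : ∀ b > a, ∀ m, P m → m ∈ V b → ∃ c < b, ∃ m', P m' ∧ m' ∈ V c) {m : M} (hm : P m) :
    ∃ m', P m' ∧ m' ∈ V a := by
  obtain ⟨b₀, hb₀⟩ := hV.exhaustive m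
  by_contra hcon
  push Not at hcon
  let T : Set ℝ := {b | ∃ m', P m' ∧ m' ∈ V b}
  have hT : ∀ b ∈ T, a < b := fun b ⟨m', h1, h2⟩ => by
    by_contra hb
    exact hcon m' h1 (hV.mono (not_lt.mp hb) h2)
  have hbdd : BddBelow T := ⟨a, fun b hb => (hT b hb).le⟩
  have hne : T.Nonempty := ⟨b₀, m, hm, hb₀⟩
  -- Right continuity makes the infimum of the attained indices itself attained; the improvement
  -- hypothesis then contradicts its minimality.
  obtain ⟨ε, hε, he⟩ := hV.rightCont (sInf T)
  obtain ⟨b, ⟨m', h1, h2⟩, hb⟩ := exists_lt_of_csInf_lt hne (lt_add_of_pos_right (sInf T) hε)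
  have hinf : m' ∈ V (sInf T) := he ▸ hV.mono hb.le h2
  obtain ⟨c, hc, hcT⟩ := hP (sInf T) (hT _ ⟨m', h1, hinf⟩) m' h1 hinf
  exact absurd (csInf_le hbdd hcT) (not_le.mpr hc)

/-- Two nested descents: the outer one lowers the index of the fixed element `m` in `W` to `a`; the
inner one lowers the index in `V` of `ops s • m`, with the list `s` of shifts growing along the way.
-/
theorem le (hV : IsVFiltration V) (hW : IsVFiltration W) (a : ℝ) : V a ≤ W a := by
  obtain ⟨K, hK⟩ := hV.exists_le_shift hW
  intro m hm
  let ops : List ℝ → RY := fun s => (s.map thetaShift).prod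
  have hops : ∀ s, ops s ∈ V0R := fun s => V0R.list_prod_mem fun x hx => by
    obtain ⟨c, -, rfl⟩ := List.mem_map.mp hx
    exact thetaShift_mem_V0R c
  suffices hstep : ∀ b > a, ∀ x, x = m → x ∈ W b → ∃ c < b, ∃ x', x' = m ∧ x' ∈ W c by
    obtain ⟨_, rfl, h⟩ := hW.mem_of_forall_lt hstep rfl
    exact h
  intro b hb x hx hmb
  subst x
  let P : M → Prop := fun x => x ∈ V a ∧ ∃ s : List ℝ, (∀ c ∈ s, c ≤ a) ∧ x = ops s • m
  -- The inner descent stops at `b - 1 - K`, where the comparison `hK` places `ops s • m` in `W (b -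
  -- 1)`, hence in `W_{<b}`. The factors of `ops s` are then cancelled one at a time, each being
  -- injective on `Gr_b` because its shift is at most `a < b`.
  suffices hstep : ∀ c > b - 1 - K, ∀ x, P x → x ∈ V c → ∃ d < c, ∃ x', P x' ∧ x' ∈ V d by
    obtain ⟨_, ⟨-, s, hs, rfl⟩, hm'⟩ := hV.mem_of_forall_lt hstep ⟨hm, [], by simp, by simp [ops]⟩
    have hlt : ops s • m ∈ VLt W b :=
      (mem_VLt hW.mono).mpr ⟨b - 1, by linarith, hW.mono (by linarith) (hK _ hm')⟩
    have hmem : m ∈ VLt W b := by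
      clear hm'
      induction s with
      | nil => simpa [ops] using hlt
      | cons c s ih =>
        rw [List.forall_mem_cons] at hs
        refine ih hs.2 (hW.mem_VLt_of_thetaShift_smul (hs.1.trans_lt hb).ne
          (smul_mem_of_mem_V0R (hops s) _ hmb) ?_)
        simpa [ops, mul_smul] using hlt
    obtain ⟨c, hc, h⟩ := (mem_VLt hW.mono).mp hmem
    exact ⟨c, hc, m, rfl, h⟩
  rintro c - x ⟨hxa, s, hs, rfl⟩ hxc
  -- Above `a` membership in `V a` already improves the index. At `c ≤ a` a power of `thetaShift c`
  -- does, and `c` is an allowed shift.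
  rcases lt_or_ge a c with hac | hac
  · exact ⟨a, hac, _, ⟨hxa, s, hs, rfl⟩, hxa⟩
  · obtain ⟨N, hN⟩ := hV.thetaShift_nilpotent c
    obtain ⟨d, hd, hmem⟩ := (mem_VLt hV.mono).mp (hN _ hxc)
    refine ⟨d, hd, _, ⟨hV.mono (hd.le.trans hac) hmem, List.replicate N c ++ s, ?_, ?_⟩, hmem⟩
    · intro e he
      rcases List.mem_append.mp he with he | he
      · exact (List.eq_of_mem_replicate he).trans_le hac
      · exact hs e he
    · simp [ops, mul_smul]

theorem eq (hV : IsVFiltration V) (hW : IsVFiltration W) : V = W :=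
  funext fun a => le_antisymm (hV.le hW a) (hW.le hV a)

end IsVFiltration
end

/-! ### The basis `q_k = ∏_{j ≤ k} z(t∂_t - α_j)` of the hypergeometric module -/

theorem RInt.induction {O ι : Type} [CommRing O] [Algebra ℂ O] {z : O} {Dz : Derivation ℂ O O}
    {Dx : ι → Derivation ℂ O O} {p : RInt z Dz Dx → Prop} (hfn : ∀ f, p (RInt.fn f))
    (hdz : p RInt.dz) (hdx : ∀ i, p (RInt.dx i)) (hadd : ∀ r s, p r → p s → p (r + s))
    (hmul : ∀ r s, p r → p s → p (r * s)) (r : RInt z Dz Dx) : p r := by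
  obtain ⟨x, rfl⟩ := RingQuot.mkAlgHom_surjective ℂ (RRel z Dz Dx) r
  induction x using FreeAlgebra.induction with
  | grade0 c =>
    have := hfn (algebraMap ℂ O c)
    rwa [AlgHom.commutes] at this ⊢
  | grade1 x =>
    cases x with
    | fn f => exact hfn f
    | dz => exact hdz
    | dx i => exact hdx i
  | mul a b ha hb => rw [map_mul]; exact hmul _ _ ha hb
  | add a b ha hb => rw [map_add]; exact hadd _ _ ha hb

theorem OX.t_zero : OX.t 0 = 1 := rfl

theorem OX.t_mul_t (a b : ℤ) : OX.t a * OX.t b = OX.t (a + b) := by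
  simp [OX.t, AddMonoidAlgebra.single_mul_single]

theorem OX.Dt_z : OX.Dt OX.z = 0 := by
  simp [OX.Dt, OX.tdt, euler_single, OX.z]

theorem OX.Dz_z : OX.Dz OX.z = OX.z * OX.z := by
  simp [OX.Dz, OX.zdz, euler_single, OX.z]

theorem OX.Dz_t (b : ℤ) : OX.Dz (OX.t b) = 0 := by
  simp [OX.Dz, OX.zdz, euler_single, OX.t]

/-- The element `t · z∂_t = z t∂_t`. -/
def ztdt : RX := RInt.fn (OX.t 1) * RInt.dx ()

theorem ztdt_commute_z : Commute ztdt (RInt.fn OX.z) := by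
  change _ * _ = _ * _
  rw [ztdt, mul_assoc, RInt.dx_mul_fn, OX.Dt_z, map_zero, add_zero, ← mul_assoc, ← mul_assoc,
    ← map_mul, ← map_mul, mul_comm OX.z]

theorem dx_eq_fn_mul_ztdt : (RInt.dx () : RX) = RInt.fn (OX.t (-1)) * ztdt := by
  rw [ztdt, ← mul_assoc, ← map_mul, OX.t_mul_t, neg_add_cancel, OX.t_zero, map_one, one_mul]

theorem dz_mul_ztdt : (RInt.dz * ztdt : RX) = ztdt * RInt.dz + RInt.fn OX.z * ztdt := by
  rw [ztdt, ← mul_assoc, RInt.dz_mul_fn, OX.Dz_t, map_zero, add_zero, mul_assoc, RInt.dz_mul_dx,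
    mul_add, mul_assoc, ← mul_assoc _ _ (RInt.dx ()), ← mul_assoc _ _ (RInt.dx ()), ← map_mul,
    ← map_mul, mul_comm OX.z]

section Hyp
variable {n : ℕ} (α : Fin n → ℝ) (γ : ℝ)

/-- The operator `z(t∂_t - α_i)`. -/
def hypFactor (i : Fin n) : RX := ztdt - RInt.fn ((α i : ℂ) • OX.z)

theorem hypFactor_eq (i : Fin n) : hypFactor α i = ztdt - (α i : ℂ) • RInt.fn OX.z := by
  rw [hypFactor, map_smul]

theorem hypFactor_commute (i j : Fin n) : Commute (hypFactor α i) (hypFactor α j) := by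
  simp only [hypFactor_eq]
  exact ((Commute.refl _).sub_right (ztdt_commute_z.smul_right _)).sub_left
    ((ztdt_commute_z.symm.smul_left _).sub_right (((Commute.refl _).smul_left _).smul_right _))

/-- The operator `∏_{j=1}^k z(t∂_t - α_j)`. -/
def hypOp (k : ℕ) : RX := ((List.ofFn (hypFactor α)).take k).prod

theorem hypOp_zero : hypOp α 0 = 1 := by simp [hypOp]

/-- The product acquires its new factor on the right. It can be moved to the left because all
factors are combinations of the commuting elements `ztdt` and `z`. -/
theorem hypOp_succ (k : Fin n) : hypOp α (k + 1) = hypFactor α k * hypOp α k := by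
  rw [hypOp, List.prod_take_succ _ _ (by simp), List.getElem_ofFn]
  refine (Commute.list_prod_right _ _ fun x hx => ?_).eq.symm
  obtain ⟨i, rfl⟩ := (List.mem_ofFn' _ _).mp (List.mem_of_mem_take hx)
  exact hypFactor_commute α k i

theorem hypOp_self : hypOp α n = opH α + RInt.fn (OX.t 1) := by
  rw [hypOp, List.take_of_length_le (by simp), opH, sub_add_cancel]
  rfl

theorem ztdt_mul_hypOp (k : Fin n) :
    ztdt * hypOp α k = hypOp α (k + 1) + (α k : ℂ) • (RInt.fn OX.z * hypOp α k) := by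
  rw [hypOp_succ, hypFactor_eq, sub_mul, smul_mul_assoc, sub_add_cancel]

theorem opP_eq : opP n γ = RInt.dz + (n : ℂ) • ztdt + (γ : ℂ) • RInt.fn OX.z := by
  rw [opP, ztdt, map_smul, map_smul, smul_mul_assoc]

theorem opP_mul_z :
    opP n γ * RInt.fn OX.z = RInt.fn OX.z * opP n γ + RInt.fn OX.z * RInt.fn OX.z := by
  rw [opP_eq]
  simp only [add_mul, mul_add, RInt.dz_mul_fn, OX.Dz_z, map_mul, smul_mul_assoc,
    ztdt_commute_z.eq, mul_smul_comm]
  abel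

theorem opP_mul_hypFactor (i : Fin n) :
    opP n γ * hypFactor α i = hypFactor α i * opP n γ + RInt.fn OX.z * hypFactor α i := by
  have h : opP n γ * ztdt = ztdt * opP n γ + RInt.fn OX.z * ztdt := by
    rw [opP_eq]
    simp only [add_mul, mul_add, dz_mul_ztdt, smul_mul_assoc, ztdt_commute_z.eq, mul_smul_comm]
    abel
  rw [hypFactor_eq, mul_sub, sub_mul, mul_sub, h, mul_smul_comm, opP_mul_z, smul_mul_assoc,
    mul_smul_comm, smul_add]
  abel

/-- Commutation with `P` is `z` times a grading in which each factor `z(t∂_t - α_i)` has degree one.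
As `P` kills the class of `1`, this yields `P q_k = k z q_k`. -/
theorem opP_mul_hypOp {k : ℕ} (hk : k ≤ n) :
    opP n γ * hypOp α k = hypOp α k * opP n γ + (k : ℂ) • (RInt.fn OX.z * hypOp α k) := by
  induction k with
  | zero => simp [hypOp_zero]
  | succ k ih =>
    have e := hypOp_succ α ⟨k, hk⟩
    simp only at e
    have hz : Commute (RInt.fn OX.z) (hypFactor α ⟨k, hk⟩) := by
      rw [hypFactor_eq]
      exact ztdt_commute_z.symm.sub_right ((Commute.refl _).smul_right _)
    rw [e, ← mul_assoc, opP_mul_hypFactor, add_mul, mul_assoc _ (opP n γ), ih (by omega), mul_add,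
      mul_smul_comm, ← mul_assoc (hypFactor α _) (RInt.fn _), ← hz.eq, mul_assoc (RInt.fn _),
      mul_assoc]
    push_cast
    rw [add_smul, one_smul, add_assoc]

/-- The class `q_k` of `∏_{j=1}^k z(t∂_t - α_j)` in the hypergeometric module. -/
def hypq (k : ℕ) : Res (Hhat α γ) := Res.of _ (Submodule.Quotient.mk (hypOp α k))

theorem smul_hypq (r : RX) (k : ℕ) :
    r • hypq α γ k = Res.of _ (Submodule.Quotient.mk (r * hypOp α k)) := rfl

theorem ztdt_smul_hypq (k : Fin n) :
    ztdt • hypq α γ k = hypq α γ (k + 1) + (α k : ℂ) • OX.z • hypq α γ k := by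
  rw [smul_hypq, ztdt_mul_hypOp]
  rfl

theorem opP_smul_hypq {k : ℕ} (hk : k ≤ n) :
    opP n γ • hypq α γ k = (k : ℂ) • OX.z • hypq α γ k := by
  have h0 : (Submodule.Quotient.mk (hypOp α k * opP n γ) : Hhat α γ) = 0 :=
    (Submodule.Quotient.mk_eq_zero _).mpr
      (Submodule.smul_mem _ (hypOp α k) (Submodule.subset_span (by simp)))
  rw [smul_hypq, opP_mul_hypOp α γ hk, Submodule.Quotient.mk_add, h0, zero_add]
  rfl

theorem hypq_self : hypq α γ n = OX.t 1 • hypq α γ 0 := by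
  have h0 : (Submodule.Quotient.mk (opH α) : Hhat α γ) = 0 :=
    (Submodule.Quotient.mk_eq_zero _).mpr (Submodule.subset_span (by simp))
  rw [Res.OX_smul, smul_hypq, hypOp_zero, mul_one, hypq, hypOp_self, Submodule.Quotient.mk_add, h0,
    zero_add]

theorem dx_smul_hypq (k : Fin n) : (RInt.dx () : RX) • hypq α γ k =
    OX.t (-1) • (hypq α γ (k + 1) + (α k : ℂ) • OX.z • hypq α γ k) := by
  rw [dx_eq_fn_mul_ztdt, mul_smul, ztdt_smul_hypq, ← Res.OX_smul]

/-- Solving the definition of `P` for `z²∂_z` produces the numbers `k - γ - n α_{k+1}`, which become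
the orders in the filtration (indices in `Fin n` start at `0`, so `α k` is `α_{k+1}`). -/
theorem dz_smul_hypq (k : Fin n) : (RInt.dz : RX) • hypq α γ k =
    ((k - γ - n * α k : ℝ) : ℂ) • OX.z • hypq α γ k - (n : ℂ) • hypq α γ (k + 1) := by
  have e : (RInt.dz : RX) = opP n γ - (n : ℂ) • ztdt - (γ : ℂ) • RInt.fn OX.z := by
    rw [opP_eq]; abel
  rw [e, sub_smul, sub_smul, opP_smul_hypq α γ k.2.le, smul_assoc, smul_assoc, ztdt_smul_hypq,
    ← Res.OX_smul]
  push_cast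
  module

/-- The span contains the class `q_0` of `1` and is stable under the generators of the ring, hence
is everything. -/
theorem mem_span_hypq [NeZero n] (m : Res (Hhat α γ)) :
    m ∈ Submodule.span OX (Set.range fun k : Fin n => hypq α γ k) := by
  set S := Submodule.span OX (Set.range fun k : Fin n => hypq α γ k) with hS
  have hcS : ∀ (c : ℂ) x, x ∈ S → c • x ∈ S := fun c x hx => by
    have := S.smul_mem (c • (1 : OX)) hx
    rwa [smul_assoc, one_smul] at this
  have hq : ∀ k : Fin n, hypq α γ k ∈ S := fun k => Submodule.subset_span ⟨k, rfl⟩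
  have hq0 : hypq α γ 0 ∈ S := hq 0
  -- For `k = n - 1` the next class is `q_n = t q_0`, so the family closes up cyclically.
  have hq' : ∀ k : Fin n, hypq α γ (k + 1) ∈ S := fun k => by
    rcases lt_or_ge (k + 1 : ℕ) n with h | h
    · exact hq ⟨k + 1, h⟩
    · rw [show (k + 1 : ℕ) = n by omega, hypq_self]
      exact S.smul_mem _ hq0
  have hder : ∀ (δ : RX) (D : Derivation ℂ OX OX),
      (∀ g : OX, δ * RInt.fn g = RInt.fn g * δ + RInt.fn (D g)) →
      (∀ k : Fin n, δ • hypq α γ k ∈ S) → ∀ x ∈ S, δ • x ∈ S := by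
    intro δ D h hδ x hx
    induction hx using Submodule.span_induction with
    | mem x hx => obtain ⟨k, rfl⟩ := hx; exact hδ k
    | zero => rw [smul_zero]; exact S.zero_mem
    | add x y _ _ hx hy => rw [smul_add]; exact S.add_mem hx hy
    | smul g x hxS hx =>
      rw [Res.OX_smul, ← mul_smul, h, add_smul, mul_smul, ← Res.OX_smul, ← Res.OX_smul]
      exact S.add_mem (S.smul_mem _ hx) (S.smul_mem _ hxS)
  have key : ∀ r : RX, ∀ x ∈ S, r • x ∈ S := by
    intro r
    induction r using RInt.induction with
    | hfn f => exact fun x hx => S.smul_mem f hx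
    | hdz =>
      refine hder _ _ RInt.dz_mul_fn fun k => ?_
      rw [dz_smul_hypq]
      exact S.sub_mem (hcS _ _ (S.smul_mem _ (hq k))) (hcS _ _ (hq' k))
    | hdx i =>
      refine hder _ _ (RInt.dx_mul_fn i) fun k => ?_
      rw [dx_smul_hypq]
      exact S.smul_mem _ (S.add_mem (hq' k) (hcS _ _ (S.smul_mem _ (hq k))))
    | hadd r s hr hs => exact fun x hx => by rw [add_smul]; exact S.add_mem (hr x hx) (hs x hx)
    | hmul r s hr hs => exact fun x hx => by rw [mul_smul]; exact hr _ (hs x hx)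
  obtain ⟨r, rfl⟩ := Submodule.Quotient.mk_surjective _ m
  have := key r _ hq0
  rwa [smul_hypq, hypOp_zero, mul_one] at this

end Hyp

/-! ### A model of the hypergeometric module

On `ℂ[z, s, s⁻¹]` with `t = sⁿ`, the operator `z t∂_t` acts by
`z^a s^j ↦ z^a s^{j+1} + A_j z^{a+1} s^j` and the class `q_k` corresponds to `s^k`. -/

/-- The linear map on `ℂ[G]` with prescribed values on monomials. -/
def monomialLin {G : Type} {X : Type} [AddCommGroup X] [Module ℂ X] (φ : G → X) :
    AddMonoidAlgebra ℂ G →ₗ[ℂ] X :=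
  Finsupp.linearCombination ℂ φ ∘ₗ (AddMonoidAlgebra.coeffLinearEquiv ℂ).toLinearMap

theorem monomialLin_single {G : Type} {X : Type} [AddCommGroup X] [Module ℂ X] (φ : G → X) (g : G)
    (c : ℂ) : monomialLin φ (AddMonoidAlgebra.single g c) = c • φ g := by
  simp [monomialLin]

/-- The substitution `t ↦ sⁿ`. -/
def powSubst (n : ℕ) : OX →ₐ[ℂ] OX :=
  AddMonoidAlgebra.mapDomainAlgHom ℂ ℂ
    ((AddMonoidHom.id ℕ).prodMap (AddMonoidHom.mulLeft (n : ℤ)))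

theorem powSubst_single (n : ℕ) (p : ℕ × ℤ) (c : ℂ) :
    powSubst n (AddMonoidAlgebra.single p c) = AddMonoidAlgebra.single (p.1, n * p.2) c := by
  simp [powSubst, Prod.map]

/-- The substitution `t ↦ sⁿ` in the presence of `τ`. -/
def powSubstTau (n : ℕ) : OY →ₐ[ℂ] OY :=
  AddMonoidAlgebra.mapDomainAlgHom ℂ ℂ
    ((AddMonoidHom.id ℕ).prodMap ((AddMonoidHom.mulLeft (n : ℤ)).prodMap (AddMonoidHom.id ℤ)))

theorem powSubstTau_single (n : ℕ) (p : ℕ × ℤ × ℤ) (c : ℂ) :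
    powSubstTau n (AddMonoidAlgebra.single p c) =
      AddMonoidAlgebra.single (p.1, n * p.2.1, p.2.2) c := by
  simp [powSubstTau, Prod.map]

theorem powSubstTau_mu (n : ℕ) (g : OX) : powSubstTau n (mu g) = mu (powSubst n g) := by
  induction g using AddMonoidAlgebra.induction_linear with
  | zero => simp
  | add x y hx hy => simp only [map_add, hx, hy]
  | single p c => simp [mu_single, powSubst_single, powSubstTau_single]

section Hyp
variable {n : ℕ} (α : Fin n → ℝ) (γ : ℝ)

/-- The exponents extended to integers by `α_{j+n} = α_j + 1`. -/
def extExp (j : ℤ) : ℂ :=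
  (j / n : ℤ) + if h : (j % n).toNat < n then (α ⟨(j % n).toNat, h⟩ : ℂ) else 0

theorem extExp_natCast (k : Fin n) : extExp α (k : ℕ) = α k := by
  have h1 : ((k : ℕ) : ℤ) % n = (k : ℕ) := Int.emod_eq_of_lt (by omega) (by omega)
  have h2 : ((k : ℕ) : ℤ) / n = 0 := Int.ediv_eq_zero_of_lt (by omega) (by omega)
  simp [extExp, h1, h2]

/-- This quasi-periodicity is exactly the Leibniz rule for `t^b`, which acts on the model as
`s^{nb}`. -/
theorem extExp_add_mul [NeZero n] (j b : ℤ) : extExp α (j + n * b) = extExp α j + b := by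
  have hn : (n : ℤ) ≠ 0 := by exact_mod_cast NeZero.ne n
  simp only [extExp, Int.add_mul_emod_self_left, Int.add_mul_ediv_left _ _ hn]
  push_cast
  ring

theorem extExp_sub [NeZero n] (j : ℤ) : extExp α (j - n) = extExp α j - 1 := by
  have := extExp_add_mul α j (-1)
  simpa [← sub_eq_add_neg] using this

/-- The action of `z∂_t` on the model. -/
def modelDt : Module.End ℂ OX :=
  monomialLin fun p => AddMonoidAlgebra.single (p.1, p.2 + 1 - n) 1 +
    AddMonoidAlgebra.single (p.1 + 1, p.2 - n) (extExp α p.2)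

/-- The action of `z²∂_z` on the model. -/
def modelDz : Module.End ℂ OX :=
  monomialLin fun p =>
    AddMonoidAlgebra.single (p.1 + 1, p.2) (p.1 + p.2 - γ - n * extExp α p.2) -
      AddMonoidAlgebra.single (p.1, p.2 + 1) (n : ℂ)

theorem modelDt_single (p : ℕ × ℤ) (c : ℂ) : modelDt α (AddMonoidAlgebra.single p c) =
    AddMonoidAlgebra.single (p.1, p.2 + 1 - n) c +
      AddMonoidAlgebra.single (p.1 + 1, p.2 - n) (c * extExp α p.2) := by
  simp [modelDt, monomialLin_single]

theorem modelDz_single (p : ℕ × ℤ) (c : ℂ) : modelDz α γ (AddMonoidAlgebra.single p c) =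
    AddMonoidAlgebra.single (p.1 + 1, p.2) (c * (p.1 + p.2 - γ - n * extExp α p.2)) -
      AddMonoidAlgebra.single (p.1, p.2 + 1) (c * n) := by
  rw [modelDz, monomialLin_single, smul_sub, AddMonoidAlgebra.smul_single,
    AddMonoidAlgebra.smul_single, smul_eq_mul, smul_eq_mul]

/-- The action of functions on the model. -/
def modelFn (n : ℕ) : OX →ₐ[ℂ] Module.End ℂ OX := (Algebra.lmul ℂ OX).comp (powSubst n)

theorem modelFn_apply (n : ℕ) (f g : OX) : modelFn n f g = powSubst n f * g := rfl

theorem single_eq_add {G : Type} {a b c : G} {x y z : ℂ} (hb : a = b) (hc : a = c)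
    (h : x = y + z) : AddMonoidAlgebra.single a x =
      AddMonoidAlgebra.single b y + AddMonoidAlgebra.single c z := by
  subst hb hc h
  exact AddMonoidAlgebra.single_add _ _ _

theorem end_ext_monomial {A B : Module.End ℂ OX}
    (h : ∀ p c, A (AddMonoidAlgebra.single p c) = B (AddMonoidAlgebra.single p c)) : A = B := by
  refine LinearMap.ext fun x => ?_
  induction x using AddMonoidAlgebra.induction_linear with
  | zero => simp
  | add x y hx hy => simp only [map_add, hx, hy]
  | single p c => exact h p c

variable [NeZero n]

theorem modelDt_modelFn (f : OX) :
    modelDt α * modelFn n f = modelFn n f * modelDt α + modelFn n (OX.Dt f) := by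
  induction f using AddMonoidAlgebra.induction_linear with
  | zero => simp
  | add x y hx hy => simp only [map_add, mul_add, add_mul, hx, hy]; abel
  | single q r =>
    refine end_ext_monomial fun p c => ?_
    simp only [Module.End.mul_apply, LinearMap.add_apply, modelFn_apply, powSubst_single,
      modelDt_single, AddMonoidAlgebra.single_mul_single, OX.Dt, OX.tdt, Derivation.smul_apply,
      euler_single, smul_eq_mul, OX.z, OX.t, mul_add]
    have hA : extExp α (n * q.2 + p.2) = extExp α p.2 + q.2 := by
      rw [add_comm, extExp_add_mul]
    rw [add_assoc]
    refine congrArg₂ (· + ·) ?_ (single_eq_add ?_ ?_ ?_)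
    · congr 1
      ext <;> simp
      ring
    · ext <;> simp <;> ring
    · ext <;> simp <;> ring
    · rw [Prod.snd_add, hA]
      simp only [AddMonoidHom.comp_apply, Int.coe_castAddHom, AddMonoidHom.coe_snd]
      ring

theorem modelDz_modelFn (f : OX) :
    modelDz α γ * modelFn n f = modelFn n f * modelDz α γ + modelFn n (OX.Dz f) := by
  induction f using AddMonoidAlgebra.induction_linear with
  | zero => simp
  | add x y hx hy => simp only [map_add, mul_add, add_mul, hx, hy]; abel
  | single q r =>
    refine end_ext_monomial fun p c => ?_
    simp only [Module.End.mul_apply, LinearMap.add_apply, modelFn_apply, powSubst_single,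
      modelDz_single, AddMonoidAlgebra.single_mul_single, OX.Dz, OX.zdz, Derivation.smul_apply,
      euler_single, smul_eq_mul, OX.z, mul_sub]
    have hA : extExp α (n * q.2 + p.2) = extExp α p.2 + q.2 := by
      rw [add_comm, extExp_add_mul]
    rw [sub_add_eq_add_sub]
    refine congrArg₂ (· - ·) (single_eq_add ?_ ?_ ?_) ?_
    · ext <;> simp
      ring
    · ext <;> simp
      ring
    · rw [Prod.snd_add, hA]
      simp only [AddMonoidHom.comp_apply, Nat.coe_castAddMonoidHom, AddMonoidHom.coe_fst,
        Prod.fst_add]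
      push_cast
      ring
    · congr 1
      · ext <;> simp
        ring
      · ring

theorem modelDz_modelDt : modelDz α γ * modelDt α =
    modelDt α * modelDz α γ + modelFn n OX.z * modelDt α := by
  refine end_ext_monomial fun p c => ?_
  simp only [Module.End.mul_apply, LinearMap.add_apply, modelFn_apply, powSubst_single, map_add,
      map_sub, modelDz_single, modelDt_single, AddMonoidAlgebra.single_mul_single, OX.z]
  have k1 : (((1 : ℕ), (n : ℤ) * 0) + (p.1, p.2 + 1 - n) : ℕ × ℤ) = (p.1 + 1, p.2 + 1 - n) := by
    ext <;> simp [add_comm]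
  have k2 : (((1 : ℕ), (n : ℤ) * 0) + (p.1 + 1, p.2 - n) : ℕ × ℤ) = (p.1 + 1 + 1, p.2 - n) := by
    ext <;> simp [add_comm]
  obtain ⟨E, hE⟩ : ∃ E : ℕ × ℤ → OX, ∀ k x, AddMonoidAlgebra.single k x = x • E k :=
    ⟨fun k => AddMonoidAlgebra.single k 1, fun k x => by simp⟩
  simp only [k1, k2, extExp_sub, hE, sub_add_eq_add_sub]
  push_cast
  module


/-- The ring `ℛ_𝒳^int` acting on the model. -/
def modelAct : RX →ₐ[ℂ] Module.End ℂ OX :=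
  RInt.lift (A := Module.End ℂ OX) (modelFn n) (modelDz α γ) (fun _ => modelDt α)
    (modelDz_modelFn α γ) (fun _ => modelDt_modelFn α) (fun _ => modelDz_modelDt α γ)
    (fun _ _ => rfl)

theorem modelAct_fn (f g : OX) : modelAct α γ (RInt.fn f) g = powSubst n f * g := by
  rw [modelAct, RInt.lift_fn, modelFn_apply]

theorem modelAct_dz : modelAct α γ RInt.dz = modelDz α γ := by
  rw [modelAct, RInt.lift_dz]

theorem modelAct_ztdt (p : ℕ × ℤ) (c : ℂ) :
    modelAct α γ ztdt (AddMonoidAlgebra.single p c) =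
      AddMonoidAlgebra.single (p.1, p.2 + 1) c +
        AddMonoidAlgebra.single (p.1 + 1, p.2) (c * extExp α p.2) := by
  rw [ztdt, map_mul, Module.End.mul_apply, modelAct_fn, modelAct, RInt.lift_dx, modelDt_single,
    mul_add, OX.t, powSubst_single, AddMonoidAlgebra.single_mul_single,
    AddMonoidAlgebra.single_mul_single]
  congr 2 <;> simp

/-- On `s^k` the term with `extExp α k = α k` cancels against `- α_k z`, leaving only the shift to
`s^{k+1}`. -/
theorem modelAct_hypOp {k : ℕ} (hk : k ≤ n) :
    modelAct α γ (hypOp α k) 1 = AddMonoidAlgebra.single (0, (k : ℤ)) 1 := by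
  induction k with
  | zero => rw [hypOp_zero, map_one (modelAct α γ)]; rfl
  | succ k ih =>
    have e := hypOp_succ α ⟨k, hk⟩
    have hA := extExp_natCast α ⟨k, hk⟩
    simp only at e hA
    rw [e, map_mul, Module.End.mul_apply, ih (by omega), hypFactor, map_sub, LinearMap.sub_apply,
      modelAct_ztdt, modelAct_fn, hA, map_smul, OX.z, powSubst_single]
    simp [AddMonoidAlgebra.single_mul_single]

theorem modelAct_opH : modelAct α γ (opH α) 1 = 0 := by
  have e : opH α = hypOp α n - RInt.fn (OX.t 1) := by rw [hypOp_self, add_sub_cancel_right]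
  rw [e, map_sub, LinearMap.sub_apply, modelAct_hypOp α γ le_rfl, modelAct_fn, OX.t,
    powSubst_single]
  simp

/-- `modelDz` is obtained by requiring `P` to act as `z^a s^j ↦ (a + j) z^{a+1} s^j`; this vanishes
at `a = j = 0`. -/
theorem modelAct_opP : modelAct α γ (opP n γ) 1 = 0 := by
  have e : (1 : OX) = AddMonoidAlgebra.single (0, 0) 1 := rfl
  rw [opP_eq, map_add, map_add, map_smul, map_smul, LinearMap.add_apply, LinearMap.add_apply,
    LinearMap.smul_apply, LinearMap.smul_apply, modelAct_fn, modelAct_dz, e, modelDz_single,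
    modelAct_ztdt, OX.z, powSubst_single, AddMonoidAlgebra.single_mul_single]
  obtain ⟨E, hE⟩ : ∃ E : ℕ × ℤ → OX, ∀ k x, AddMonoidAlgebra.single k x = x • E k :=
    ⟨fun k => AddMonoidAlgebra.single k 1, fun k x => by simp⟩
  simp only [hE, Prod.mk_add_mk, add_zero, zero_add, mul_zero]
  push_cast
  module

/-- The model as an `ℛ_𝒳^int`-module. -/
def HypModel (_ : Fin n → ℝ) (_ : ℝ) : Type := OX

instance : AddCommGroup (HypModel α γ) := inferInstanceAs (AddCommGroup OX)
instance : Module RX (HypModel α γ) := Module.compHom OX (modelAct α γ).toRingHom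

/-- The map from the hypergeometric module to the model. -/
def toModel : Hhat α γ →ₗ[RX] HypModel α γ :=
  Submodule.liftQ _ (LinearMap.toSpanSingleton RX (HypModel α γ) (1 : OX)) <| by
    refine Submodule.span_le.mpr ?_
    rintro _ (rfl | rfl)
    · exact modelAct_opP α γ
    · exact modelAct_opH α γ

/-- The map to the model as an additive map. -/
def resToModel : Res (Hhat α γ) →+ OX := (toModel α γ).toAddMonoidHom

theorem resToModel_smul (g : OX) (m : Res (Hhat α γ)) :
    resToModel α γ (g • m) = powSubst n g * resToModel α γ m :=
  (map_smul (toModel α γ) (RInt.fn g : RX) m).trans (modelAct_fn α γ g _)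

theorem resToModel_hypq {k : ℕ} (hk : k ≤ n) :
    resToModel α γ (hypq α γ k) = AddMonoidAlgebra.single (0, (k : ℤ)) 1 :=
  modelAct_hypOp α γ hk

/-- The additive map `f ⊗ m ↦ f(z, sⁿ, τ) · m(z/τ, s)` from the rescaled hypergeometric module. -/
def rescaleToModel : tauHhat α γ →+ OY :=
  TensorProduct.liftAddHom
    (AddMonoidHom.mk' (fun f => (AddMonoidHom.mulLeft (powSubstTau n f)).comp
        ((mu : OX →+ OY).comp (resToModel α γ)))
      fun f f' => AddMonoidHom.ext fun m => by
        simp [add_mul])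
    fun g f m => by
      simp only [AddMonoidHom.mk'_apply, AddMonoidHom.comp_apply, AddMonoidHom.coe_mulLeft,
        AddMonoidHom.coe_coe]
      rw [resToModel_smul, OX_smul_OY, map_mul, map_mul, powSubstTau_mu]
      ring

theorem rescaleToModel_mk_hypq (f : OY) {k : ℕ} (hk : k ≤ n) :
    rescaleToModel α γ (Rescale.mk f (hypq α γ k)) =
      powSubstTau n f * AddMonoidAlgebra.single (0, (k : ℤ), 0) 1 := by
  change powSubstTau n f * mu (resToModel α γ (hypq α γ k)) = _
  rw [resToModel_hypq α γ hk, mu_single]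
  rfl

/-- Division with remainder by `n`: in the summand coming from `q_k` every exponent of `s` is
congruent to `k`, so different summands share no monomial and each coefficient can be read off
separately. -/
theorem coeff_powSubstTau_mul (f : OY) (k k' : Fin n) (p : ℕ × ℤ × ℤ) :
    (powSubstTau n f * AddMonoidAlgebra.single (0, (k' : ℤ), 0) 1).coeff
      (p.1, n * p.2.1 + k, p.2.2) = if k' = k then f.coeff p else 0 := by
  induction f using AddMonoidAlgebra.induction_linear with
  | zero => simp
  | add x y hx hy =>
    rw [map_add, add_mul, AddMonoidAlgebra.coeff_add, Finsupp.add_apply, hx, hy]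
    split_ifs <;> simp
  | single q r =>
    have hdiv : ∀ (b : ℤ) (j : Fin n), ((n : ℤ) * b + (j : ℕ)) / n = b ∧
        ((n : ℤ) * b + (j : ℕ)) % n = (j : ℕ) := fun b j => by
      have h1 : (((j : ℕ) : ℤ)) % n = (j : ℕ) := Int.emod_eq_of_lt (by omega) (by omega)
      have h2 : (((j : ℕ) : ℤ)) / n = 0 := Int.ediv_eq_zero_of_lt (by omega) (by omega)
      have hn : (n : ℤ) ≠ 0 := by exact_mod_cast NeZero.ne n
      rw [add_comm, Int.add_mul_ediv_left _ _ hn, Int.add_mul_emod_self_left, h1, h2, zero_add]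
      exact ⟨rfl, rfl⟩
    have hiff : (((q.1, (n : ℤ) * q.2.1, q.2.2) + (0, (k' : ℤ), 0) : ℕ × ℤ × ℤ) =
        (p.1, n * p.2.1 + k, p.2.2)) ↔ k' = k ∧ q = p := by
      constructor
      · intro h
        simp only [Prod.mk_add_mk, add_zero, Prod.mk.injEq] at h
        obtain ⟨h1, h2, h3⟩ := h
        refine ⟨?_, Prod.ext h1 (Prod.ext ?_ h3)⟩
        · have := congrArg (· % (n : ℤ)) h2
          simp only [(hdiv _ _).2] at this
          exact Fin.ext (by exact_mod_cast this)
        · have := congrArg (· / (n : ℤ)) h2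
          simpa only [(hdiv _ _).1] using this
      · rintro ⟨rfl, rfl⟩
        simp
    classical
    rw [powSubstTau_single, AddMonoidAlgebra.single_mul_single, mul_one,
      AddMonoidAlgebra.coeff_single, Finsupp.single_apply, AddMonoidAlgebra.coeff_single,
      Finsupp.single_apply, ← ite_and]
    simp only [hiff]

/-- The classes `1 ⊗ q_k` are linearly independent over `𝒪(*)`. -/
theorem eq_zero_of_sum_smul_hypq {g : Fin n → OY}
    (h : ∑ k, g k • (Rescale.mk 1 (hypq α γ k) : tauHhat α γ) = 0) (k : Fin n) : g k = 0 := by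
  refine AddMonoidAlgebra.ext (Finsupp.ext fun p => ?_)
  have h1 := congrArg (fun x : OY => x.coeff (p.1, n * p.2.1 + k, p.2.2))
    (congrArg (rescaleToModel α γ) h)
  simp only [map_sum, Rescale.smul_mk, mul_one, map_zero, AddMonoidAlgebra.coeff_sum,
    Finsupp.finsetSum_apply, AddMonoidAlgebra.coeff_zero, Finsupp.zero_apply] at h1
  simp only [rescaleToModel_mk_hypq α γ _ (Fin.is_le' : ((_ : Fin n) : ℕ) ≤ n),
    coeff_powSubstTau_mul] at h1
  simpa using h1

end Hyp

/-! ### Functions with prescribed exponents of `τ` -/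

/-- The functions in `𝒪(*)` all of whose exponents of `τ` lie in `I`. -/
def tauSupp (I : Set ℤ) : Submodule ℂ OY := AddMonoidAlgebra.supported ℂ ℂ {p | p.2.2 ∈ I}

theorem mem_tauSupp {I : Set ℤ} {f : OY} : f ∈ tauSupp I ↔ ∀ p, f.coeff p ≠ 0 → p.2.2 ∈ I := by
  simp [tauSupp, AddMonoidAlgebra.mem_supported, Set.subset_def]

theorem tauSupp_mono {I J : Set ℤ} (h : I ⊆ J) : tauSupp I ≤ tauSupp J := fun _ hf =>
  mem_tauSupp.mpr fun p hp => h (mem_tauSupp.mp hf p hp)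

theorem single_mem_tauSupp {I : Set ℤ} {p : ℕ × ℤ × ℤ} (hp : p.2.2 ∈ I) (c : ℂ) :
    AddMonoidAlgebra.single p c ∈ tauSupp I := by
  classical
  refine mem_tauSupp.mpr fun q hq => ?_
  rw [AddMonoidAlgebra.coeff_single, Finsupp.single_apply] at hq
  split_ifs at hq with h
  · exact h ▸ hp
  · exact absurd rfl hq

theorem tauSupp_induction {I : Set ℤ} {P : OY → Prop} (zero : P 0)
    (add : ∀ f g, P f → P g → P (f + g))
    (single : ∀ p : ℕ × ℤ × ℤ, p.2.2 ∈ I → ∀ c, P (AddMonoidAlgebra.single p c))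
    {f : OY} (hf : f ∈ tauSupp I) : P f := by
  rw [← AddMonoidAlgebra.sum_coeff_single f]
  refine Finset.sum_induction _ P add zero fun p hp => single p ?_ _
  exact mem_tauSupp.mp hf p (Finsupp.mem_support_iff.mp hp)

theorem mul_mem_tauSupp {I J K : Set ℤ} (h : ∀ i ∈ I, ∀ j ∈ J, i + j ∈ K) {f g : OY}
    (hf : f ∈ tauSupp I) (hg : g ∈ tauSupp J) : f * g ∈ tauSupp K := by
  classical
  refine mem_tauSupp.mpr fun p hp => ?_
  have := AddMonoidAlgebra.support_coeff_mul_subset f g (Finsupp.mem_support_iff.mpr hp)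
  obtain ⟨q, hq, r, hr, rfl⟩ := Finset.mem_add.mp this
  exact h _ (mem_tauSupp.mp hf q (Finsupp.mem_support_iff.mp hq)) _
    (mem_tauSupp.mp hg r (Finsupp.mem_support_iff.mp hr))

theorem euler_mem_tauSupp {I : Set ℤ} (w : ℕ × ℤ × ℤ →+ ℂ) {f : OY} (hf : f ∈ tauSupp I) :
    euler w f ∈ tauSupp I := by
  refine tauSupp_induction (P := fun f => euler w f ∈ tauSupp I) (by simp)
    (fun f g hf hg => ?_) (fun p hp c => ?_) hf
  · rw [map_add]; exact add_mem hf hg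
  · rw [euler_single]; exact single_mem_tauSupp hp _

theorem tau_mul_mem_tauSupp {I J : Set ℤ} {c : ℤ} (h : ∀ i ∈ I, c + i ∈ J) {f : OY}
    (hf : f ∈ tauSupp I) : OY.tau c * f ∈ tauSupp J :=
  mul_mem_tauSupp (I := {c}) (fun i hi j hj => by rw [Set.mem_singleton_iff.mp hi]; exact h j hj)
    (single_mem_tauSupp (p := (0, 0, c)) (Set.mem_singleton c) 1) hf

theorem zero_tau_mul_mem_tauSupp {I : Set ℤ} {f g : OY} (hf : f ∈ tauSupp {0})
    (hg : g ∈ tauSupp I) : f * g ∈ tauSupp I :=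
  mul_mem_tauSupp (fun i hi j hj => by rwa [Set.mem_singleton_iff.mp hi, zero_add]) hf hg

theorem z_mem_tauSupp : OY.z ∈ tauSupp {0} :=
  single_mem_tauSupp (p := (1, 0, 0)) (Set.mem_singleton 0) 1

theorem t_mem_tauSupp (b : ℤ) : OY.t b ∈ tauSupp {0} :=
  single_mem_tauSupp (p := (0, b, 0)) (Set.mem_singleton 0) 1

theorem single_eq_monomial (a : ℕ) (b c : ℤ) (r : ℂ) :
    (AddMonoidAlgebra.single (a, b, c) r : OY) = r • (OY.z ^ a * OY.t b * OY.tau c) := by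
  simp [OY.z, OY.t, OY.tau, AddMonoidAlgebra.single_pow, AddMonoidAlgebra.single_mul_single]

theorem OY.t_mem_Otau (b : ℤ) : OY.t b ∈ Otau := by
  have hpow : ∀ (e : ℤ) (m : ℕ), OY.t (e * m) = OY.t e ^ m := fun e m => by
    simp [OY.t, AddMonoidAlgebra.single_pow, mul_comm]
  have h1 : ∀ e : ℤ, OY.t e ∈ Otau → ∀ m : ℕ, OY.t (e * m) ∈ Otau := fun e he m =>
    hpow e m ▸ Otau.pow_mem he m
  obtain ⟨m, rfl | rfl⟩ := b.eq_nat_or_neg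
  · simpa using h1 1 (Algebra.subset_adjoin (by simp)) m
  · simpa using h1 (-1) (Algebra.subset_adjoin (by simp)) m

theorem mem_Otau_iff {f : OY} : f ∈ Otau ↔ f ∈ tauSupp (Set.Ici 0) := by
  constructor
  · intro hf
    induction hf using Algebra.adjoin_induction with
    | mem x hx => rcases hx with rfl | rfl | rfl | rfl <;> exact single_mem_tauSupp (by simp) 1
    | algebraMap r => exact single_mem_tauSupp (by simp) r
    | add x y _ _ hx hy => exact add_mem hx hy
    | mul x y _ _ hx hy =>
      exact mul_mem_tauSupp (fun i hi j hj => Set.mem_Ici.mpr (add_nonneg hi hj)) hx hy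
  · intro hf
    refine tauSupp_induction (zero_mem _) (fun f g => add_mem) (fun p hp c => ?_) hf
    obtain ⟨a, b, e⟩ := p
    obtain ⟨m, rfl⟩ := Int.eq_ofNat_of_zero_le (Set.mem_Ici.mp hp)
    have htau : OY.tau (m : ℤ) = OY.tau 1 ^ m := by simp [OY.tau, AddMonoidAlgebra.single_pow]
    rw [single_eq_monomial, htau]
    exact Otau.smul_mem (Otau.mul_mem (Otau.mul_mem (Otau.pow_mem OY.z_mem_Otau _)
      (OY.t_mem_Otau b)) (Otau.pow_mem (Algebra.subset_adjoin (by simp)) _)) _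

theorem coeff_aeval_z (p : Polynomial ℂ) (k : ℕ) :
    (Polynomial.aeval OY.z p).coeff (k, 0, 0) = p.coeff k := by
  classical
  induction p using Polynomial.induction_on' with
  | add p q hp hq => simp [hp, hq]
  | monomial m c =>
    rw [Polynomial.aeval_monomial, ← Algebra.smul_def, OY.z, AddMonoidAlgebra.single_pow]
    simp [Finsupp.single_apply, Polynomial.coeff_monomial]

theorem aeval_z_ne_zero {p : Polynomial ℂ} (hp : p ≠ 0) : Polynomial.aeval OY.z p ≠ 0 :=
  fun h => hp (Polynomial.ext fun k => by rw [← coeff_aeval_z, h]; simp)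

theorem aeval_z_mem_tauSupp (p : Polynomial ℂ) : Polynomial.aeval OY.z p ∈ tauSupp {0} := by
  induction p using Polynomial.induction_on' with
  | add p q hp hq => rw [map_add]; exact add_mem hp hq
  | monomial m c =>
    rw [Polynomial.aeval_monomial, ← Algebra.smul_def, OY.z, AddMonoidAlgebra.single_pow,
      AddMonoidAlgebra.smul_single]
    exact single_mem_tauSupp (by simp) _

/-- `𝒪(*)` modulo the functions with exponents in `I` has no `ℂ[z]`-torsion. -/
theorem mem_tauSupp_of_aeval_mul {I : Set ℤ} {p : Polynomial ℂ} (hp : p ≠ 0) {f : OY}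
    (h : Polynomial.aeval OY.z p * f ∈ tauSupp I) : f ∈ tauSupp I := by
  classical
  -- Multiplication by a polynomial in `z` preserves exponents of `τ`. So the product with the part
  -- `f₂` of `f` outside `I` is supported both in `I` and in its complement; it is zero, and `𝒪(*)`
  -- is a domain.
  set f₁ : OY := .ofCoeff (f.coeff.filter fun q => q.2.2 ∈ I)
  set f₂ : OY := .ofCoeff (f.coeff.filter fun q => ¬ q.2.2 ∈ I)
  have hf : f = f₁ + f₂ := by
    refine AddMonoidAlgebra.ext ?_
    exact (Finsupp.filter_add_filter_not _ _).symm
  have h₁ : f₁ ∈ tauSupp I := mem_tauSupp.mpr fun q hq => by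
    by_contra hqI
    exact hq (Finsupp.filter_apply_neg _ _ hqI)
  have h₂ : f₂ ∈ tauSupp Iᶜ := mem_tauSupp.mpr fun q hq hqI =>
    hq (Finsupp.filter_apply_neg _ _ (not_not.mpr hqI))
  have e : Polynomial.aeval OY.z p * f₂ = Polynomial.aeval OY.z p * f -
      Polynomial.aeval OY.z p * f₁ := by rw [hf]; ring
  have h3 : Polynomial.aeval OY.z p * f₂ ∈ tauSupp I :=
    e ▸ sub_mem h (zero_tau_mul_mem_tauSupp (aeval_z_mem_tauSupp p) h₁)
  have h4 := zero_tau_mul_mem_tauSupp (aeval_z_mem_tauSupp p) h₂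
  have h5 : Polynomial.aeval OY.z p * f₂ = 0 := by
    refine AddMonoidAlgebra.ext (Finsupp.ext fun q => ?_)
    by_contra hq
    exact mem_tauSupp.mp h4 q hq (mem_tauSupp.mp h3 q hq)
  rw [hf, (mul_eq_zero.mp h5).resolve_left (aeval_z_ne_zero hp), add_zero]
  exact h₁

theorem Dt_mem_tauSupp {I : Set ℤ} {f : OY} (hf : f ∈ tauSupp I) : OY.Dt f ∈ tauSupp I :=
  zero_tau_mul_mem_tauSupp (zero_tau_mul_mem_tauSupp z_mem_tauSupp (t_mem_tauSupp _))
    (euler_mem_tauSupp _ hf)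

theorem tau_mul_Dtau (f : OY) : OY.tau 1 * OY.Dtau f = OY.z * OY.taudtau f := by
  have : OY.tau 1 * OY.tau (-1) = 1 := OY.tau_mul_tau 1 (-1)
  rw [OY.Dtau, Derivation.smul_apply, smul_eq_mul]
  linear_combination OY.z * OY.taudtau f * this

theorem isNoetherianRing_Otau : IsNoetherianRing Otau := by
  have : Algebra.FiniteType ℂ Otau := Otau.fg_iff_finiteType.mp
    (Subalgebra.fg_def.mpr ⟨_, Set.toFinite _, rfl⟩)
  exact Algebra.FiniteType.isNoetherianRing ℂ Otau

/-! ### The action on the basis of the rescaled hypergeometric module -/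

namespace Rescale
variable {N : Type} [AddCommGroup N] [Module RX N]

theorem fn_smul (f : OY) (x : Rescale N) : (RInt.fn f : RY) • x = f • x := by
  change act (RInt.fn f) x = _
  rw [act, RInt.lift_fn]
  rfl

theorem dx_smul_smul (c : Coord) (f : OY) (x : Rescale N) :
    (RInt.dx c : RY) • f • x = f • (RInt.dx c : RY) • x + OY.Dx c f • x := by
  rw [← fn_smul, ← mul_smul, RInt.dx_mul_fn, add_smul, mul_smul, fn_smul, fn_smul]

theorem mk_csmul (f : OY) (c : ℂ) (m : Res N) : mk f (c • m) = c • mk f m := by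
  have e : c • m = (c • (1 : OX)) • m := by rw [smul_assoc, one_smul]
  rw [e, mk_smul, map_smul, map_one, smul_one_mul, csmul_mk]

theorem csmul_eq (c : ℂ) (x : Rescale N) : (c • (1 : RY)) • x = c • x := by
  rw [← map_one RInt.fn, ← map_smul, fn_smul, smul_assoc, one_smul]

end Rescale

open Rescale

section Hyp
variable {n : ℕ} (α : Fin n → ℝ) (γ : ℝ)

/-- The class `1 ⊗ q_k` in the rescaled hypergeometric module. -/
def hype (k : ℕ) : tauHhat α γ := Rescale.mk 1 (hypq α γ k)

/-- The order `k - γ - n α_{k+1}` of `Q_k`. -/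
def hypOrd (k : Fin n) : ℝ := k - γ - n * α k

theorem mk_hypq (f : OY) (k : ℕ) : (Rescale.mk f (hypq α γ k) : tauHhat α γ) = f • hype α γ k := by
  rw [hype, Rescale.smul_mk, mul_one]

theorem mk_z_smul_hypq (k : ℕ) :
    (Rescale.mk (OY.tau 1) (OX.z • hypq α γ k) : tauHhat α γ) = OY.z • hype α γ k := by
  rw [Rescale.mk_smul, mul_comm, tau_mul_mu_z, mk_hypq]

theorem hype_self : hype α γ n = OY.t 1 • hype α γ 0 := by
  have : mu (OX.t 1) = OY.t 1 := by simp [OX.t, OY.t, mu_single]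
  rw [hype, hypq_self, Rescale.mk_smul, mul_one, this, mk_hypq]

theorem dt_smul_hype (k : Fin n) : (RInt.dx Coord.t : RY) • hype α γ k =
    (OY.t (-1) * OY.tau 1) • hype α γ (k + 1) + ((α k : ℂ) • (OY.t (-1) * OY.z)) • hype α γ k := by
  have ht : mu (OX.t (-1)) = OY.t (-1) := by simp [OX.t, OY.t, mu_single]
  rw [hype, dt_smul_mk, dx_smul_hypq, Derivation.map_one_eq_zero, zero_mk, zero_add, mul_one,
    Rescale.mk_smul, ht, ← Rescale.smul_mk, mk_add, mk_csmul, mk_z_smul_hypq, mk_hypq, smul_add,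
    ← mul_smul, smul_assoc, mul_smul _ OY.z, smul_comm (OY.t (-1)) (α k : ℂ)]
  rfl

/-- The operator `zτ∂_τ`. -/
def theta : RY := RInt.fn (OY.tau 1) * RInt.dx Coord.tau

theorem theta_smul_smul (f : OY) (x : tauHhat α γ) :
    theta • f • x = f • theta • x + (OY.z * OY.taudtau f) • x := by
  rw [theta, mul_smul, mul_smul, dx_smul_smul, smul_add, fn_smul, fn_smul, fn_smul, OY.Dx,
    ← mul_smul, ← mul_smul, ← mul_smul, tau_mul_Dtau, mul_comm f]

/-- The formula behind the whole filtration: `-τ ⊗ z²∂_z q_k`, with `τ · (z/τ) = z`. The diagonal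
coefficient is minus the order, and the other term raises both `k` and the exponent of `τ`. -/
theorem theta_smul_hype (k : Fin n) : theta • hype α γ k =
    ((n : ℂ) • OY.tau 1) • hype α γ (k + 1) - ((hypOrd α γ k : ℂ) • OY.z) • hype α γ k := by
  rw [theta, mul_smul, hype, dtau_smul_mk, Derivation.map_one_eq_zero, zero_mk, zero_add, mul_one,
    neg_mk, smul_neg, fn_smul_mk, mul_one, dz_smul_hypq, sub_eq_add_neg, mk_add, mk_csmul,
    mk_z_smul_hypq, ← neg_smul, mk_csmul, mk_hypq, neg_smul, neg_add, neg_neg, smul_assoc,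
    smul_assoc, hypOrd, add_comm, ← sub_eq_add_neg]
  rfl

variable [NeZero n]

theorem exists_eq_sum_smul_hype (x : tauHhat α γ) : ∃ g : Fin n → OY, x = ∑ k, g k • hype α γ k := by
  induction x using Rescale.induction with
  | zero => exact ⟨0, by simp⟩
  | mk f m =>
    obtain ⟨g, rfl⟩ := (Submodule.mem_span_range_iff_exists_fun OX).mp (mem_span_hypq α γ m)
    refine ⟨fun k => mu (g k) * f, ?_⟩
    have : ∀ s : Finset (Fin n), (Rescale.mk f (∑ k ∈ s, g k • hypq α γ k) : tauHhat α γ) =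
        ∑ k ∈ s, (mu (g k) * f) • hype α γ k := fun s => by
      induction s using Finset.induction_on with
      | empty => exact TensorProduct.tmul_zero _ _
      | insert k s hk ih =>
        rw [Finset.sum_insert hk, Finset.sum_insert hk, mk_add, ih, Rescale.mk_smul, mk_hypq]
    exact this _
  | add x y hx hy =>
    obtain ⟨g, rfl⟩ := hx
    obtain ⟨h, rfl⟩ := hy
    exact ⟨g + h, by simp [add_smul, Finset.sum_add_distrib]⟩

end Hyp

open Rescale Topology

/-! ### The filtration `^τU` -/

section Hyp
variable {n : ℕ} (α : Fin n → ℝ) (γ : ℝ)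

/-- The elements `∑ g_k ⊗ q_k` for which the exponents of `τ` in `g_k` lie in `S k`. -/
def hypLat (S : Fin n → Set ℤ) : AddSubgroup (tauHhat α γ) where
  carrier := {x | ∃ g : Fin n → OY, (∀ k, g k ∈ tauSupp (S k)) ∧ x = ∑ k, g k • hype α γ k}
  zero_mem' := ⟨0, fun _ => zero_mem _, by simp⟩
  add_mem' := by
    rintro _ _ ⟨g, hg, rfl⟩ ⟨h, hh, rfl⟩
    exact ⟨g + h, fun k => add_mem (hg k) (hh k), by simp [add_smul, Finset.sum_add_distrib]⟩
  neg_mem' := by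
    rintro _ ⟨g, hg, rfl⟩
    exact ⟨-g, fun k => neg_mem (hg k), by simp [neg_smul]⟩

variable {α γ}

theorem smul_hype_mem_hypLat {S : Fin n → Set ℤ} {k : Fin n} {g : OY} (hg : g ∈ tauSupp (S k)) :
    g • hype α γ k ∈ hypLat α γ S := by
  classical
  refine ⟨Pi.single k g, fun l => ?_, ?_⟩
  · rcases eq_or_ne l k with rfl | h
    · rwa [Pi.single_eq_same]
    · rw [Pi.single_eq_of_ne h]; exact zero_mem _
  · simp [Pi.single_apply, ite_smul]

theorem hypLat_mono {S T : Fin n → Set ℤ} (h : ∀ k, S k ⊆ T k) : hypLat α γ S ≤ hypLat α γ T := by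
  rintro _ ⟨g, hg, rfl⟩
  exact ⟨g, fun k => tauSupp_mono (h k) (hg k), rfl⟩

theorem smul_mem_of_hypLat {S : Fin n → Set ℤ} {L : AddSubgroup (tauHhat α γ)} (r : RY)
    (h : ∀ k, ∀ g ∈ tauSupp (S k), r • g • hype α γ k ∈ L) {x : tauHhat α γ}
    (hx : x ∈ hypLat α γ S) : r • x ∈ L := by
  obtain ⟨g, hg, rfl⟩ := hx
  rw [Finset.smul_sum]
  exact L.sum_mem fun k _ => h k _ (hg k)

theorem smul_mem_hypLat {S T : Fin n → Set ℤ} {f : OY}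
    (h : ∀ k, ∀ g ∈ tauSupp (S k), f * g ∈ tauSupp (T k)) {x : tauHhat α γ}
    (hx : x ∈ hypLat α γ S) : f • x ∈ hypLat α γ T := by
  rw [← fn_smul]
  refine smul_mem_of_hypLat _ (fun k g hg => ?_) hx
  rw [fn_smul, ← mul_smul]
  exact smul_hype_mem_hypLat (h k g hg)

theorem sum_smul_hype_mem_hypLat_iff [NeZero n] {S : Fin n → Set ℤ} {g : Fin n → OY} :
    ∑ k, g k • hype α γ k ∈ hypLat α γ S ↔ ∀ k, g k ∈ tauSupp (S k) := by
  refine ⟨fun ⟨h, hh, e⟩ k => ?_, fun h => ⟨g, h, rfl⟩⟩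
  have : g k - h k = 0 := by
    refine eq_zero_of_sum_smul_hypq α γ (g := g - h) ?_ k
    have := sub_eq_zero.mpr e
    rw [← Finset.sum_sub_distrib] at this
    simp only [← sub_smul] at this
    exact this
  exact sub_eq_zero.mp this ▸ hh k

variable (α γ)

/-- The exponents `ν` for which `τ^ν Q_k` has order at most `a`, and less than `a` if `k < j`. -/
def ordIdx (a : ℝ) (j : ℕ) (k : Fin n) : Set ℤ :=
  {ν | hypOrd α γ k - ν ≤ a ∧ ((k : ℕ) < j → hypOrd α γ k - ν < a)}

theorem ordIdx_anti (a : ℝ) {i j : ℕ} (h : i ≤ j) (k : Fin n) :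
    ordIdx α γ a j k ⊆ ordIdx α γ a i k :=
  fun _ hν => ⟨hν.1, fun hk => hν.2 (hk.trans_le h)⟩

theorem mem_ordIdx_zero {a : ℝ} {k : Fin n} {ν : ℤ} :
    ν ∈ ordIdx α γ a 0 k ↔ hypOrd α γ k - ν ≤ a := by simp [ordIdx]

theorem mem_ordIdx_self {a : ℝ} {k : Fin n} {ν : ℤ} :
    ν ∈ ordIdx α γ a n k ↔ hypOrd α γ k - ν < a := by
  simp only [ordIdx, Set.mem_ofPred_eq, k.2, forall_const, and_iff_right_iff_imp]
  exact le_of_lt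

theorem mul_mem_tauSupp_ordIdx {a : ℝ} {j : ℕ} {k : Fin n} {f g : OY} (hf : f ∈ Otau)
    (hg : g ∈ tauSupp (ordIdx α γ a j k)) : f * g ∈ tauSupp (ordIdx α γ a j k) := by
  refine mul_mem_tauSupp (fun i hi ν hν => ?_) (mem_Otau_iff.mp hf) hg
  have hi' : (0 : ℝ) ≤ i := by exact_mod_cast Set.mem_Ici.mp hi
  refine ⟨?_, fun h => ?_⟩
  · have := hν.1
    push_cast
    linarith
  · have := hν.2 h
    push_cast
    linarith

theorem nu_eq (a : ℝ) (k : Fin n) : nu α γ a k = ⌈hypOrd α γ k - a⌉ := by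
  rw [nu, hypOrd]
  congr 1
  ring

theorem mem_ordIdx_iff_nu_le {a : ℝ} {k : Fin n} {ν : ℤ} :
    ν ∈ ordIdx α γ a 0 k ↔ nu α γ a k ≤ ν := by
  rw [mem_ordIdx_zero, nu_eq, Int.ceil_le, sub_le_comm]

/-! ### Action of `z∂_t` and `zτ∂_τ` on the lattices -/

section Mono
variable {α}

/-- The inequalities `α_1 ≤ … ≤ α_n < α_1 + 1` enter here: `ord_{k+1} ≤ ord_k + 1`, so the extra `τ`
compensates the passage to `e_{k+1}`. -/
theorem tau_mul_smul_hype_succ_mem (hα : ∀ i, α i ∈ Set.Ico (0 : ℝ) 1) (hmono : Monotone α)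
    {a : ℝ} {j : ℕ} {k : Fin n} {g : OY}
    (hg : g ∈ tauSupp (ordIdx α γ a j k)) :
    (OY.tau 1 * g) • hype α γ (k + 1) ∈ hypLat α γ (ordIdx α γ a (j + 1)) := by
  have hn : (0 : ℝ) < n := by exact_mod_cast k.pos
  rcases lt_or_ge (k + 1 : ℕ) n with h | h
  · have hle : n * α k ≤ n * α ⟨k + 1, h⟩ :=
      mul_le_mul_of_nonneg_left (hmono (by simp [Fin.le_def])) hn.le
    have hord : hypOrd α γ ⟨k + 1, h⟩ ≤ hypOrd α γ k + 1 := by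
      simp only [hypOrd]
      push_cast
      linarith
    refine smul_hype_mem_hypLat (k := ⟨k + 1, h⟩) (tau_mul_mem_tauSupp (fun ν hν => ?_) hg)
    refine ⟨?_, fun hlt => ?_⟩
    · have := hν.1
      push_cast
      linarith
    · have := hν.2 (by simpa using hlt)
      push_cast
      linarith
  -- Wrap-around `k = n - 1`: the target is `t e_0`, and the order drops strictly, as required for
  -- the index `0 < j + 1`.
  · have h0 : n * α k < n * (α ⟨0, k.pos⟩ + 1) :=
      mul_lt_mul_of_pos_left (by linarith [(hα k).2, (hα ⟨0, k.pos⟩).1]) hn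
    have hk : ((k : ℕ) : ℝ) + 1 = n := by exact_mod_cast (show (k + 1 : ℕ) = n by omega)
    have hord : hypOrd α γ ⟨0, k.pos⟩ < hypOrd α γ k + 1 := by
      simp only [hypOrd]
      push_cast
      linarith
    rw [show (k + 1 : ℕ) = n by omega, hype_self, ← mul_smul, mul_comm _ (OY.t 1)]
    refine smul_hype_mem_hypLat (k := ⟨0, k.pos⟩)
      (zero_tau_mul_mem_tauSupp (t_mem_tauSupp 1) (tau_mul_mem_tauSupp (fun ν hν => ?_) hg))
    have := hν.1
    have hlt : hypOrd α γ ⟨0, k.pos⟩ - ((1 + ν : ℤ) : ℝ) < a := by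
      push_cast
      linarith
    exact ⟨hlt.le, fun _ => hlt⟩

/-- The lattices for `j = 0, …, n` interpolate between `U_a` and `U_{<a}`, and `zτ∂_τ + a z`
advances one step. The diagonal factor `a - order` removes terms of order exactly `a`; the other
term carries the strict inequality from `k < j` to `k + 1 < j + 1`. -/
theorem thetaShift_smul_mem (hα : ∀ i, α i ∈ Set.Ico (0 : ℝ) 1) (hmono : Monotone α)
    {a : ℝ} {j : ℕ} {x : tauHhat α γ}
    (hx : x ∈ hypLat α γ (ordIdx α γ a j)) :
    thetaShift a • x ∈ hypLat α γ (ordIdx α γ a (j + 1)) := by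
  refine smul_mem_of_hypLat _ (fun k g hg => ?_) hx
  refine tauSupp_induction (P := fun g => thetaShift a • g • hype α γ k ∈
    hypLat α γ (ordIdx α γ a (j + 1))) (by simp)
    (fun f g hf hg => by rw [add_smul, smul_add]; exact add_mem hf hg) (fun p hp c => ?_) hg
  set g : OY := AddMonoidAlgebra.single p c
  have hg : g ∈ tauSupp (ordIdx α γ a j k) := single_mem_tauSupp hp c
  have hE : OY.taudtau g = (p.2.2 : ℂ) • g := by
    simp [g, OY.taudtau, euler_single]
  have e : thetaShift a • g • hype α γ k = ((n : ℂ) • (OY.tau 1 * g)) • hype α γ (k + 1) +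
      (OY.z * (((a - (hypOrd α γ k - p.2.2) : ℝ) : ℂ) • g)) • hype α γ k := by
    change (theta + _) • _ = _
    have h1 : g * ((n : ℂ) • OY.tau 1) = (n : ℂ) • (OY.tau 1 * g) := by
      rw [mul_smul_comm, mul_comm]
    have h2 : OY.z * (((a - (hypOrd α γ k - p.2.2) : ℝ) : ℂ) • g) =
        OY.z * ((p.2.2 : ℂ) • g) - g * ((hypOrd α γ k : ℂ) • OY.z) + ((a : ℂ) • OY.z) * g := by
      simp only [mul_smul_comm, smul_mul_assoc, mul_comm g]
      push_cast
      module
    rw [add_smul, theta_smul_smul, theta_smul_hype, hE, fn_smul, smul_sub, ← mul_smul, ← mul_smul,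
      ← mul_smul, h1, h2, add_smul, sub_smul]
    abel
  rw [e, ← mul_smul_comm]
  refine add_mem (tau_mul_smul_hype_succ_mem γ hα hmono (Submodule.smul_mem _ _ hg)) ?_
  rcases eq_or_lt_of_le hp.1 with h | h
  · rw [h, sub_self, Complex.ofReal_zero, zero_smul, mul_zero, zero_smul]
    exact zero_mem _
  · exact smul_hype_mem_hypLat (zero_tau_mul_mem_tauSupp z_mem_tauSupp
      (Submodule.smul_mem _ _ (single_mem_tauSupp (I := ordIdx α γ a (j + 1) k)
        ⟨h.le, fun _ => h⟩ c)))

theorem dt_smul_mem (hα : ∀ i, α i ∈ Set.Ico (0 : ℝ) 1) (hmono : Monotone α)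
    {a : ℝ} {x : tauHhat α γ} (hx : x ∈ hypLat α γ (ordIdx α γ a 0)) :
    (RInt.dx Coord.t : RY) • x ∈ hypLat α γ (ordIdx α γ a 0) := by
  refine smul_mem_of_hypLat _ (fun k g hg => ?_) hx
  have h1 : g * (OY.t (-1) * OY.tau 1) = OY.tau 1 * (OY.t (-1) * g) := by ring
  rw [dx_smul_smul, dt_smul_hype, smul_add, ← mul_smul, ← mul_smul, h1, mul_comm g]
  refine add_mem (add_mem ?_ (smul_hype_mem_hypLat ?_)) (smul_hype_mem_hypLat (Dt_mem_tauSupp hg))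
  · exact hypLat_mono (ordIdx_anti α γ a zero_le_one) (tau_mul_smul_hype_succ_mem γ hα hmono
      (zero_tau_mul_mem_tauSupp (t_mem_tauSupp _) hg))
  · rw [smul_mul_assoc]
    exact Submodule.smul_mem _ _ (zero_tau_mul_mem_tauSupp
      (zero_tau_mul_mem_tauSupp (t_mem_tauSupp _) z_mem_tauSupp) hg)

theorem theta_smul_mem (hα : ∀ i, α i ∈ Set.Ico (0 : ℝ) 1) (hmono : Monotone α)
    {a : ℝ} {x : tauHhat α γ} (hx : x ∈ hypLat α γ (ordIdx α γ a 0)) :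
    theta • x ∈ hypLat α γ (ordIdx α γ a 0) := by
  have e : theta • x = thetaShift a • x - ((a : ℂ) • OY.z) • x := by
    rw [← fn_smul, ← sub_smul]
    congr 1
    exact (add_sub_cancel_right _ _).symm
  rw [e]
  exact sub_mem (hypLat_mono (ordIdx_anti α γ a zero_le_one) (thetaShift_smul_mem γ hα hmono hx))
    (smul_mem_hypLat (fun k g hg => mul_mem_tauSupp_ordIdx α γ
      (Otau.smul_mem OY.z_mem_Otau _) hg) hx)

variable (hα : ∀ i, α i ∈ Set.Ico (0 : ℝ) 1) (hmono : Monotone α)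

/-- The filtration `^τU` by `V₀ℛ`-submodules. -/
def hypU (a : ℝ) : Submodule V0R (tauHhat α γ) :=
  { (hypLat α γ (ordIdx α γ a 0)).toAddSubmonoid with
    smul_mem' := by
      rintro ⟨r, hr⟩ x hx
      change r • x ∈ hypLat α γ (ordIdx α γ a 0)
      induction hr using Algebra.adjoin_induction generalizing x with
      | mem r hr =>
        rcases hr with ⟨f, hf, rfl⟩ | rfl | rfl
        · rw [fn_smul]
          exact smul_mem_hypLat (fun k g hg => mul_mem_tauSupp_ordIdx α γ hf hg) hx
        · exact dt_smul_mem γ hα hmono hx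
        · exact theta_smul_mem γ hα hmono hx
      | algebraMap c =>
        rw [← AlgHom.commutes RInt.fn, fn_smul]
        exact smul_mem_hypLat (fun k g hg => mul_mem_tauSupp_ordIdx α γ
          (Otau.algebraMap_mem c) hg) hx
      | add r s _ _ hr hs => rw [add_smul]; exact add_mem (hr hx) (hs hx)
      | mul r s _ _ hr hs => rw [mul_smul]; exact hr (hs hx) }

/-! ### The axioms of a canonical `V`-filtration for `^τU` -/

theorem hypU_mono : Monotone (hypU γ hα hmono) := fun _ _ hab _ hx =>
  hypLat_mono (fun _ _ hν => (mem_ordIdx_zero α γ).mpr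
    (((mem_ordIdx_zero α γ).mp hν).trans hab)) hx

theorem mem_VLt_hypU {a : ℝ} {x : tauHhat α γ} :
    x ∈ VLt (hypU γ hα hmono) a ↔ x ∈ hypLat α γ (ordIdx α γ a n) := by
  rw [mem_VLt (hypU_mono γ hα hmono)]
  constructor
  · rintro ⟨b, hb, hx⟩
    exact hypLat_mono (fun k ν hν => (mem_ordIdx_self α γ).mpr
      (((mem_ordIdx_zero α γ).mp hν).trans_lt hb)) hx
  · rintro ⟨g, hg, rfl⟩
    -- An element involves finitely many monomials, all of order less than `a`, so a single `b < a`
    -- bounds their orders.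
    have key : ∀ᶠ b in 𝓝[<] a, ∀ k : Fin n, ∀ p ∈ (g k).coeff.support,
        hypOrd α γ k - p.2.2 ≤ b := by
      refine Filter.eventually_all.mpr fun k => (Finset.eventually_all _).mpr fun p hp => ?_
      have := (mem_ordIdx_self α γ).mp (mem_tauSupp.mp (hg k) p (Finsupp.mem_support_iff.mp hp))
      filter_upwards [Ioo_mem_nhdsLT this] with b hb using hb.1.le
    obtain ⟨b, hb, hba⟩ := (key.and self_mem_nhdsWithin).exists
    refine ⟨b, hba, g, fun k => mem_tauSupp.mpr fun p hp => ?_, rfl⟩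
    exact (mem_ordIdx_zero α γ).mpr (hb k p (Finsupp.mem_support_iff.mpr hp))

theorem tau_smul_mem_hypU {a : ℝ} (j : ℤ) {x : tauHhat α γ} (hx : x ∈ hypU γ hα hmono a) :
    (RInt.fn (OY.tau j) : RY) • x ∈ hypU γ hα hmono (a - j) := by
  rw [fn_smul]
  refine smul_mem_hypLat (fun k g hg => tau_mul_mem_tauSupp (fun ν hν => ?_) hg) hx
  rw [mem_ordIdx_zero] at hν ⊢
  push_cast
  linarith

theorem exists_hypU_add_eq (a : ℝ) : ∃ ε > 0, hypU γ hα hmono (a + ε) = hypU γ hα hmono a := by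
  have key : ∀ᶠ ε in 𝓝[>] (0 : ℝ), ∀ k : Fin n, ∀ ν : ℤ,
      hypOrd α γ k - ν ≤ a + ε → hypOrd α γ k - ν ≤ a := by
    refine Filter.eventually_all.mpr fun k => ?_
    -- The distance from `a` to the smallest order `hypOrd α γ k - ν` exceeding `a`, attained at `ν
    -- = ⌈hypOrd α γ k - a⌉ - 1`.
    have hδ : 0 < hypOrd α γ k - a - ⌈hypOrd α γ k - a⌉ + 1 := by
      linarith [Int.ceil_lt_add_one (hypOrd α γ k - a)]
    filter_upwards [Ioo_mem_nhdsGT hδ] with ε hε ν hν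
    have h1 : ((⌈hypOrd α γ k - a⌉ - 1 : ℤ) : ℝ) < ν := by
      push_cast
      linarith [hε.2]
    have h2 : ⌈hypOrd α γ k - a⌉ ≤ ν := by
      have : ⌈hypOrd α γ k - a⌉ - 1 < ν := by exact_mod_cast h1
      omega
    linarith [Int.ceil_le.mp h2]
  obtain ⟨ε, hε, hpos⟩ := (key.and self_mem_nhdsWithin).exists
  have hpos : 0 < ε := hpos
  refine ⟨ε, hpos, le_antisymm (fun x hx => ?_) (hypU_mono γ hα hmono (by linarith))⟩
  exact hypLat_mono (fun k ν hν => (mem_ordIdx_zero α γ).mpr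
    (hε k ν ((mem_ordIdx_zero α γ).mp hν))) hx

theorem finite_jumps_hypU (a b : ℝ) :
    {c ∈ Set.Icc a b | VLt (hypU γ hα hmono) c ≠ hypU γ hα hmono c}.Finite := by
  -- A jump at `c` forces `c = hypOrd α γ k - ν` for some `k` and some integer `ν`, and only
  -- finitely many such numbers lie in `[a, b]`.
  refine (Set.finite_iUnion fun k : Fin n => (Set.finite_Icc ⌈hypOrd α γ k - b⌉
    ⌊hypOrd α γ k - a⌋).image fun ν : ℤ => hypOrd α γ k - ν).subset ?_
  rintro c ⟨hc, hne⟩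
  by_contra hcon
  refine hne (le_antisymm (fun x hx => ?_) fun x hx => ?_)
  · exact hypLat_mono (ordIdx_anti α γ c (Nat.zero_le n)) ((mem_VLt_hypU γ hα hmono).mp hx)
  · refine (mem_VLt_hypU γ hα hmono).mpr (hypLat_mono (fun k ν hν => ?_) hx)
    rw [mem_ordIdx_self]
    refine lt_of_le_of_ne ((mem_ordIdx_zero α γ).mp hν) fun h => hcon ?_
    refine Set.mem_iUnion.mpr ⟨k, ν, ⟨Int.ceil_le.mpr ?_, Int.le_floor.mpr ?_⟩, h⟩
    · linarith [hc.2]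
    · linarith [hc.1]

theorem exists_eq_sum_tau_nu {a : ℝ} {x : tauHhat α γ} (hx : x ∈ hypU γ hα hmono a) :
    ∃ f : Fin n → Otau, x = ∑ k, ((f k : OY) * OY.tau (nu α γ a k)) • hype α γ k := by
  obtain ⟨g, hg, rfl⟩ := hx
  refine ⟨fun k => ⟨OY.tau (-nu α γ a k) * g k, mem_Otau_iff.mpr
    (tau_mul_mem_tauSupp (fun ν hν => ?_) (hg k))⟩, Finset.sum_congr rfl fun k _ => ?_⟩
  · have := (mem_ordIdx_iff_nu_le α γ).mp hν
    exact Set.mem_Ici.mpr (by omega)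
  · have h : OY.tau (nu α γ a k) * OY.tau (-nu α γ a k) = 1 := by
      rw [OY.tau_mul_tau, add_neg_cancel, OY.tau_zero]
    congr 1
    linear_combination (-g k) * h

theorem tau_nu_smul_hype_mem (a : ℝ) (k : Fin n) :
    OY.tau (nu α γ a k) • hype α γ k ∈ hypU γ hα hmono a :=
  smul_hype_mem_hypLat (single_mem_tauSupp (p := (0, 0, nu α γ a k))
    ((mem_ordIdx_iff_nu_le α γ).mpr le_rfl) 1)

theorem isCoherentModule_hypU (a : ℝ) : IsCoherentModule V0R (hypU γ hα hmono a) := by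
  have := isNoetherianRing_Otau
  let i : Otau →+* V0R := ((RInt.fn (z := OY.z) (Dz := OY.Dz) (Dx := OY.Dx)).toRingHom.comp
    Otau.val.toRingHom).codRestrict V0R fun f => fn_mem_V0R f.2
  -- The two generators `z∂_t` and `zτ∂_τ` of `V₀ℛ` over `𝒪`; both induce derivations preserving
  -- `𝒪`.
  let δ : Bool → V0R := fun b => bif b then ⟨RInt.dx Coord.t, Algebra.subset_adjoin (by simp)⟩
    else ⟨theta, Algebra.subset_adjoin (by simp [theta])⟩
  have hDt : ∀ f : Otau, OY.Dt f ∈ Otau := fun f =>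
    mem_Otau_iff.mpr (Dt_mem_tauSupp (mem_Otau_iff.mp f.2))
  have hDtau : ∀ f : Otau, OY.tau 1 * OY.Dtau f ∈ Otau := fun f => by
    rw [tau_mul_Dtau]
    exact Otau.mul_mem OY.z_mem_Otau (mem_Otau_iff.mpr (euler_mem_tauSupp _ (mem_Otau_iff.mp f.2)))
  let d : Bool → Otau → Otau := fun b f => bif b then ⟨_, hDt f⟩ else ⟨_, hDtau f⟩
  refine isCoherentModule_of_finite_restrict i δ d ?_ ?_ ⟨n, fun k => ⟨_, tau_nu_smul_hype_mem γ
    hα hmono a k⟩, fun x => ?_⟩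
  · rintro (_ | _) f
    · refine Subtype.ext ?_
      change theta * RInt.fn (f : OY) = RInt.fn (f : OY) * theta + RInt.fn _
      rw [theta, mul_assoc, RInt.dx_mul_fn, mul_add, ← mul_assoc, ← mul_assoc, ← map_mul,
        ← map_mul, ← map_mul, mul_comm (OY.tau 1) (f : OY)]
      rfl
    · exact Subtype.ext (RInt.dx_mul_fn Coord.t (f : OY))
  · refine eq_top_iff.mpr fun ⟨r, hr⟩ _ => ?_
    induction hr using Algebra.adjoin_induction with
    | mem r hr =>
      rcases hr with ⟨f, hf, rfl⟩ | rfl | rfl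
      · exact Subring.subset_closure (Or.inl ⟨⟨f, hf⟩, rfl⟩)
      · exact Subring.subset_closure (Or.inr ⟨true, rfl⟩)
      · exact Subring.subset_closure (Or.inr ⟨false, rfl⟩)
    | algebraMap c =>
      exact Subring.subset_closure (Or.inl ⟨algebraMap ℂ Otau c,
        Subtype.ext (AlgHom.commutes (RInt.fn (z := OY.z) (Dz := OY.Dz) (Dx := OY.Dx)) c)⟩)
    | add r s h1 h2 hr hs => exact Subring.add_mem _ (hr trivial) (hs trivial)
    | mul r s h1 h2 hr hs => exact Subring.mul_mem _ (hr trivial) (hs trivial)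
  · obtain ⟨f, hf⟩ := exists_eq_sum_tau_nu γ hα hmono x.2
    refine ⟨f, Subtype.ext ?_⟩
    rw [hf, AddSubmonoidClass.coe_finsetSum]
    refine Finset.sum_congr rfl fun k _ => ?_
    rw [mul_smul, ← fn_smul]
    rfl

theorem isVFiltration_hypU [NeZero n] : IsVFiltration (hypU γ hα hmono) where
  mono := hypU_mono γ hα hmono
  exhaustive m := by
    obtain ⟨g, rfl⟩ := exists_eq_sum_smul_hype α γ m
    have key : ∀ᶠ b in Filter.atTop, ∀ k : Fin n, ∀ p ∈ (g k).coeff.support,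
        hypOrd α γ k - p.2.2 ≤ b :=
      Filter.eventually_all.mpr fun k => (Finset.eventually_all _).mpr fun p _ =>
        Filter.eventually_ge_atTop _
    obtain ⟨b, hb⟩ := key.exists
    refine ⟨b, g, fun k => mem_tauSupp.mpr fun p hp => ?_, rfl⟩
    exact (mem_ordIdx_zero α γ).mpr (hb k p (Finsupp.mem_support_iff.mpr hp))
  rightCont := exists_hypU_add_eq γ hα hmono
  jumps := finite_jumps_hypU γ hα hmono
  coherent := isCoherentModule_hypU γ hα hmono
  tau_smul a m := by
    constructor
    · intro hm
      refine ⟨(RInt.fn (OY.tau (-1)) : RY) • m, ?_, ?_⟩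
      · simpa using tau_smul_mem_hypU γ hα hmono (-1) hm
      · rw [← mul_smul, ← map_mul, OY.tau_mul_tau, add_neg_cancel, OY.tau_zero, map_one, one_smul]
    · rintro ⟨m', hm', rfl⟩
      simpa using tau_smul_mem_hypU γ hα hmono 1 hm'
  dtau_smul a m hm := by
    -- `z∂_τ = τ⁻¹ · zτ∂_τ`, where `zτ∂_τ` preserves `U_a` and `τ⁻¹` raises the index by one.
    have h := tau_smul_mem_hypU γ hα hmono (-1) (theta_smul_mem γ hα hmono hm)
    rw [theta, ← mul_smul, ← mul_assoc, ← map_mul, OY.tau_mul_tau, neg_add_cancel, OY.tau_zero,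
      map_one, one_mul] at h
    simpa using h
  strict a p hp m _ h := by
    obtain ⟨g, rfl⟩ := exists_eq_sum_smul_hype α γ m
    rw [mem_VLt_hypU, fn_smul, Finset.smul_sum] at h
    simp only [← mul_smul] at h
    rw [sum_smul_hype_mem_hypLat_iff] at h
    rw [mem_VLt_hypU, sum_smul_hype_mem_hypLat_iff]
    exact fun k => mem_tauSupp_of_aeval_mul hp (h k)
  nilpotent a := by
    refine ⟨n, fun m hm => (mem_VLt_hypU γ hα hmono).mpr ?_⟩
    have key : ∀ N : ℕ, thetaShift a ^ N • m ∈ hypLat α γ (ordIdx α γ a N) := by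
      intro N
      induction N with
      | zero =>
        rw [pow_zero, one_smul]
        exact hm
      | succ N ih =>
        rw [pow_succ', mul_smul]
        exact thetaShift_smul_mem γ hα hmono ih
    exact key n

end Mono

/-! ### The explicit description of `^τU` -/

/-- The factor `τ` from the chain rule cancels `τ⁻¹`, and `z/τ` is the pull-back of `z`; hence `Q_k`
is `(-n)^k ⊗ q_k`. -/
theorem factor_smul_mk (j : Fin n) (m : Res (Hhat α γ)) :
    (RInt.fn (OY.tau (-1)) * (RInt.fn (OY.t 1) * RInt.dx Coord.t -
      RInt.fn ((α j : ℂ) • OY.z)) : RY) • (Rescale.mk 1 m : tauHhat α γ) =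
    Rescale.mk 1 (hypFactor α j • m) := by
  have ht : mu (OX.t 1) = OY.t 1 := by simp [OX.t, OY.t, mu_single]
  have hz : OY.tau (-1) * OY.z = mu OX.z := by
    rw [← tau_mul_mu_z, ← mul_assoc, OY.tau_mul_tau, neg_add_cancel, OY.tau_zero, one_mul]
  have h1 : OY.tau (-1) * (OY.t 1 * OY.tau 1) = mu (OX.t 1) * 1 := by
    rw [mul_left_comm, OY.tau_mul_tau, neg_add_cancel, OY.tau_zero, ht]
  have h2 : OY.tau (-1) * ((α j : ℂ) • OY.z) = mu ((α j : ℂ) • OX.z) * 1 := by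
    rw [mul_smul_comm, hz, map_smul, mul_one]
  rw [mul_smul, sub_smul, mul_smul, dt_smul_mk, Derivation.map_one_eq_zero, zero_mk, zero_add,
    mul_one, fn_smul_mk, fn_smul_mk, smul_sub, fn_smul_mk, fn_smul_mk, mul_one, h1, h2,
    ← Rescale.mk_smul, ← Rescale.mk_smul, hypFactor, sub_smul, ztdt, mul_smul, sub_eq_add_neg,
    sub_eq_add_neg, mk_add]
  congr 1
  exact (TensorProduct.tmul_neg _ _).symm

theorem opQ_smul_genOne (k : Fin n) :
    opQ α k • genOne α γ = (-(n : ℂ)) ^ (k : ℕ) • hype α γ k := by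
  have key : ∀ (l : List (Fin n)) (m : Res (Hhat α γ)),
      ((l.map fun j => RInt.fn (OY.tau (-1)) * (RInt.fn (OY.t 1) * RInt.dx Coord.t -
        RInt.fn ((α j : ℂ) • OY.z))).prod : RY) • (Rescale.mk 1 m : tauHhat α γ) =
      Rescale.mk 1 ((l.map (hypFactor α)).prod • m) := by
    intro l m
    induction l with
    | nil => simp
    | cons j l ih =>
      rw [List.map_cons, List.prod_cons, mul_smul, ih, factor_smul_mk, List.map_cons,
        List.prod_cons, mul_smul]
  rw [opQ, ← one_mul (List.prod _), ← smul_mul_assoc, mul_smul, csmul_eq, List.ofFn_eq_map,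
    ← List.map_take, genOne, key, List.map_take, ← List.ofFn_eq_map]
  congr 3
  exact congrArg (fun r => Res.of _ (Submodule.Quotient.mk r)) (mul_one (hypOp α k))

theorem tauQ_eq (ν : ℤ) (k : Fin n) :
    tauQ α γ ν k = ((-(n : ℂ)) ^ (k : ℕ) • OY.tau ν) • hype α γ k := by
  rw [tauQ, mul_smul, opQ_smul_genOne, fn_smul, smul_comm, smul_assoc]

variable {α} (hα : ∀ i, α i ∈ Set.Ico (0 : ℝ) 1) (hmono : Monotone α)

theorem hypU_subset_span_nu (a : ℝ) : (hypU γ hα hmono a : Set (tauHhat α γ)) ⊆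
    {m | ∃ f : Fin n → Otau, m = ∑ k, (RInt.fn (f k : OY) : RY) • tauQ α γ (nu α γ a k) k} := by
  intro x hx
  obtain ⟨f, rfl⟩ := exists_eq_sum_tau_nu γ hα hmono hx
  refine ⟨fun k => ((-(n : ℂ)) ^ (k : ℕ))⁻¹ • f k, Finset.sum_congr rfl fun k _ => ?_⟩
  -- The scalar `(-n)^k` relating `Q_k` to `e_k` is a unit, so it can be absorbed into the
  -- coefficient.
  have hn : (-(n : ℂ)) ^ (k : ℕ) ≠ 0 :=
    pow_ne_zero _ (neg_ne_zero.mpr (Nat.cast_ne_zero.mpr k.pos.ne'))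
  rw [tauQ_eq, fn_smul, ← mul_smul]
  congr 1
  change _ = (((-(n : ℂ)) ^ (k : ℕ))⁻¹ • (f k : OY)) * _
  rw [smul_mul_smul_comm, inv_mul_cancel₀ hn, one_smul]

theorem span_nu_subset_tauU (a : ℝ) :
    {m | ∃ f : Fin n → Otau, m = ∑ k, (RInt.fn (f k : OY) : RY) • tauQ α γ (nu α γ a k) k} ⊆
      tauU α γ a := by
  rintro _ ⟨f, rfl⟩
  exact ⟨f, nu α γ a, fun k => by
    have := (mem_ordIdx_iff_nu_le α γ).mpr (le_refl (nu α γ a k))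
    rw [mem_ordIdx_zero, hypOrd] at this
    linarith, rfl⟩

theorem tauU_subset_hypU (a : ℝ) : tauU α γ a ⊆ hypU γ hα hmono a := by
  rintro _ ⟨f, ν, hν, rfl⟩
  refine (hypU γ hα hmono a).sum_mem fun k _ => ?_
  rw [tauQ_eq]
  refine smul_mem_of_mem_V0R (fn_mem_V0R (f k).2) _ (smul_hype_mem_hypLat
    (Submodule.smul_mem _ _ (single_mem_tauSupp (p := (0, 0, ν k)) ?_ 1)))
  rw [mem_ordIdx_zero, hypOrd]
  linarith [hν k]

/-- Three inclusions in a circle: `nu` is the least admissible exponent, so the lattice lies in the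
span of the `τ^{ν_a(k)} Q_k`, which lies in `tauU`, which lies in the lattice. -/
theorem coe_hypU (a : ℝ) : (hypU γ hα hmono a : Set (tauHhat α γ)) = tauU α γ a :=
  ((hypU_subset_span_nu γ hα hmono a).trans (span_nu_subset_tauU γ a)).antisymm
    (tauU_subset_hypU γ hα hmono a)

end Hyp

end IrrHodge

end

theorem mainTheorem4 (n : ℕ) (hn : 0 < n) (α : Fin n → ℝ) (hα : ∀ i, α i ∈ Set.Ico (0 : ℝ) 1)
    (hmono : Monotone α) (γ : ℝ) :
    IrrHodge.IsStrictlyRSpecializable (IrrHodge.tauHhat α γ) ∧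
    (∀ V : ℝ → Submodule IrrHodge.V0R (IrrHodge.tauHhat α γ),
      IrrHodge.IsVFiltration V ↔
        ∀ a, (V a : Set (IrrHodge.tauHhat α γ)) = IrrHodge.tauU α γ a) ∧
    ∀ a, IrrHodge.tauU α γ a =
      {m | ∃ f : Fin n → IrrHodge.Otau,
        m = ∑ k, (IrrHodge.RInt.fn (f k : IrrHodge.OY) : IrrHodge.RY) •
          IrrHodge.tauQ α γ (IrrHodge.nu α γ a k) k} := by
  have : NeZero n := ⟨hn.ne'⟩
  have hU := IrrHodge.isVFiltration_hypU γ hα hmono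
  refine ⟨⟨_, hU⟩, fun V => ⟨fun hV a => ?_, fun hV => ?_⟩, fun a => ?_⟩
  · rw [hV.eq hU, IrrHodge.coe_hypU]
  · have : V = IrrHodge.hypU γ hα hmono := funext fun a => SetLike.coe_injective <| by
      rw [hV a, IrrHodge.coe_hypU]
    exact this ▸ hU
  · refine Set.Subset.antisymm ?_ (IrrHodge.span_nu_subset_tauU γ a)
    rw [← IrrHodge.coe_hypU γ hα hmono]
    exact IrrHodge.hypU_subset_span_nu γ hα hmono a
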